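/- Let $\Sigma$ be a finite alphabet and let $R$ be a reflexive and symmetric relation on $\Sigma$. Let $\mathcal M_\Sigma=\langle \Sigma\mid ab=ba \text{ for } (a,b)\notin R\rangle$ be the associated trace monoid, with length $|\cdot|$, and assume that it is irreducible, that is, that the graph $(\Sigma,R)$ is connected. Let $a_1\in\Sigma$. Notation. For $S\subseteq\Sigma$, $\mathcal M_S$ is the submonoid generated by $S$, and $\mu_S(X)=\sum_\gamma(-X)^{|\gamma|}$, where $\gamma$ ranges over the subsets of $S$ with $(a,b)\notin R$ for all distinct $a,b\in\gamma$, is its Möbius polynomial. For $S\ne\emptyset$, $p_S$ is the root of smallest modulus of $\mu_S$ in $\mathbb C$ (it is real and positive), and $p_\emptyset=\infty$. $B_{S,p}$ gives the mass $\mu_S(p)p^{|x|}$ to each $x\in\mathcal M_S$. Each trace $x$ is represented by its heap, a labelled poset: its elements are the positions of a word representing $x$, labelled by their letters, and its order is generated by the pairs $i\le j$ of positions whose labels are $R$-related. One writes $\max(x)\subseteq U$ if all maximal elements of the heap of $x$ have their label in $U$, and $\mathrm{Lk}(a_1)=\{b\in\Sigma : (a_1,b)\in R\}$. If $a_1$ occurs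 in $x$, $V_{a_1}(x)$ is the trace whose heap consists of the elements of the heap of $x$ that lie below (or are equal to) the first element labelled $a_1$; the traces $V_{a_1}(x)$ are called $a_1$-pyramidal and form the set $\mathrm{Pyr}_{a_1}$. With $\le$ the left divisibility order, the boundary $\partial\mathcal M_\Sigma$ is the set of infinite traces: classes of non-decreasing sequences $(x_n)$ in $\mathcal M_\Sigma$ under mutual domination ($(x_n)$ is dominated by $(y_n)$ if every $x_n$ is $\le$ some $y_k$), excluding the classes of constant sequences. It carries the $\sigma$-algebra generated by the visual cylinders $\uparrow x=\{\xi : x\le \xi\}$, $x\in\mathcal M_\Sigma$. The uniform measure at infinity is the probability measure $\mathbf B$ on $\partial\mathcal M_\Sigma$ with $\mathbf B(\uparrow x)=p_\Sigma^{|x|}$ for all $x\in\mathcal M_\Sigma$. For an infinite trace $\xi$, the class of $(x_n)$, in which $a_1$ occurs, $V_{a_1}(\xi)$ is the eventual value of $V_{a_1}(x_n)$. Claim. 1. $0<p_\Sigma<p_{\Sigma\setminus\{a_1\}}$. The distribution $B_{\Sigma\setminus\{a_1\},p_\Sigma}$ is a well-defined probability distribution on $\mathcal M_{\Sigma\setminus\{a_1\}}$,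 and it gives positive probability to $\{z : \max(z)\subseteq\mathrm{Lk}(a_1)\}$. 2. The uniform measure at infinity $\mathbf B$ exists and is unique. The map $V_{a_1}$ is well defined $\mathbf B$-almost surely, and $\mathbf B(V_{a_1}=v)=p_\Sigma^{|v|}$ for all $v\in\mathrm{Pyr}_{a_1}$. 3. Let $Z$ be a random element of $\mathcal M_{\Sigma\setminus\{a_1\}}$ distributed according to $B_{\Sigma\setminus\{a_1\},p_\Sigma}$ conditionally on $\{\max(z)\subseteq\mathrm{Lk}(a_1)\}$. Then, with probability $1$, $Z\cdot a_1\in\mathrm{Pyr}_{a_1}$; one has $\mathbb P(Z\cdot a_1=v)=p_\Sigma^{|v|}$ for all $v\in\mathrm{Pyr}_{a_1}$; and $Z\cdot a_1$ has the same law as $V_{a_1}$ under $\mathbf B$. -/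

import Mathlib

open MeasureTheory ProbabilityTheory
open scoped ENNReal

noncomputable section

universe u

/-- The commutation relations `ab = ba` for `(a, b) ∉ R`. -/
inductive TraceRel {α : Type u} (R : α → α → Prop) : FreeMonoid α → FreeMonoid α → Prop
  | comm (a b : α) (h : ¬ R a b) :
      TraceRel R (FreeMonoid.of a * FreeMonoid.of b) (FreeMonoid.of b * FreeMonoid.of a)

/-- The trace monoid `⟨α | ab = ba for (a, b) ∉ R⟩`. -/
def TraceMonoid {α : Type u} (R : α → α → Prop) : Type u :=
  PresentedMonoid (TraceRel R)

namespace TraceMonoid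

variable {α : Type u} {R : α → α → Prop}

instance : Monoid (TraceMonoid R) :=
  inferInstanceAs (Monoid (PresentedMonoid (TraceRel R)))

/-- Traces form a discrete space: every set of traces is an event. -/
instance : MeasurableSpace (TraceMonoid R) := ⊤

/-- The trace of a word. -/
def word (R : α → α → Prop) (w : List α) : TraceMonoid R :=
  PresentedMonoid.mk (TraceRel R) (FreeMonoid.ofList w)

/-- The generator of the trace monoid given by a letter. -/
def letter (R : α → α → Prop) (a : α) : TraceMonoid R :=
  PresentedMonoid.of (TraceRel R) a

/-- The additive weight of traces induced by a weight on letters. -/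
def weight (R : α → α → Prop) (f : α → ℕ) : TraceMonoid R →* Multiplicative ℕ :=
  PresentedMonoid.lift (rels := TraceRel R) (fun b => Multiplicative.ofAdd (f b)) (by
    rintro _ _ ⟨a, b, _⟩
    simp [mul_comm])

/-- The length `|x|` of a trace. -/
def len (x : TraceMonoid R) : ℕ := Multiplicative.toAdd (weight R (fun _ => 1) x)

open Classical in
/-- The number `|x|_a` of occurrences of the letter `a` in the trace `x`. -/
def count (a : α) (x : TraceMonoid R) : ℕ :=
  Multiplicative.toAdd (weight R (fun b => if b = a then 1 else 0) x)

/-- The submonoid `M_S` generated by the letters of `S`. -/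
def sub (R : α → α → Prop) (S : Set α) : Submonoid (TraceMonoid R) :=
  Submonoid.closure (letter R '' S)

/-! ### Heaps -/

/-- The order of the heap represented by a word `w`: its pieces are the positions of `w`, the label
of a position is the letter found there, and the order is generated by the pairs `i ≤ j` of
positions with related labels. Two words with the same trace give isomorphic heaps. -/
def HeapLE (R : α → α → Prop) (w : List α) : Fin w.length → Fin w.length → Prop :=
  Relation.ReflTransGen fun i j => i ≤ j ∧ R (w.get i) (w.get j)

/-- `max(x) ⊆ U`: all maximal pieces of the heap of `x` have their label in `U`. -/
def MaxIn (U : Set α) (x : TraceMonoid R) : Prop :=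
  ∀ w : List α, word R w = x →
    ∀ i : Fin w.length, (∀ j, HeapLE R w i j → j = i) → w.get i ∈ U

/-- The link of a letter. -/
def link (R : α → α → Prop) (a : α) : Set α := {b | R a b}

open Classical in
/-- The word read on the pieces of the heap of `w` that lie below the piece `i`. -/
def belowWord (R : α → α → Prop) (w : List α) (i : Fin w.length) : List α :=
  ((List.finRange w.length).filter fun j => HeapLE R w j i).map w.get

/-- `V_a(x) = y`: in the heap of `x`, the pieces labelled `a` have a minimum, and the sub-heap
of the pieces below it is the heap of `y`. -/
def IsV (a : α) (x y : TraceMonoid R) : Prop :=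
  ∃ w : List α, word R w = x ∧ ∃ i : Fin w.length,
    w.get i = a ∧ (∀ j, w.get j = a → HeapLE R w i j) ∧ y = word R (belowWord R w i)

/-- The set of `a`-pyramidal traces. -/
def Pyr (R : α → α → Prop) (a : α) : Set (TraceMonoid R) :=
  {y | ∃ x : TraceMonoid R, 0 < count a x ∧ IsV a x y}

/-! ### Möbius polynomials and multiplicative probabilities -/

open Classical in
/-- The Möbius polynomial `μ_S(X) = ∑_γ (-X)^|γ|`, where `γ` ranges over the sets of pairwise
commuting distinct letters of `S`. -/
def mobius (R : α → α → Prop) (S : Finset α) : Polynomial ℝ :=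
  ∑ γ ∈ S.powerset.filter (fun γ : Finset α => (γ : Set α).Pairwise fun a b => ¬ R a b),
    (-Polynomial.X) ^ γ.card

/-- `p_S`, the smallest modulus of a complex root of `μ_S`; it is `∞` if `μ_S` has no root,
that is, for `S = ∅`. -/
def pRoot (R : α → α → Prop) (S : Finset α) : ℝ≥0∞ :=
  ⨅ (z : ℂ) (_ : Polynomial.aeval z (mobius R S) = 0), ‖z‖ₑ

/-- The distribution `B_{S,p}` on `M_S`, which gives the mass `μ_S(p) p^|x|` to each `x`. -/
def multMeasure (R : α → α → Prop) (S : Finset α) (p : ℝ) : Measure (sub R (S : Set α)) :=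
  Measure.sum fun x : sub R (S : Set α) =>
    ENNReal.ofReal ((mobius R S).eval p * p ^ len (x : TraceMonoid R)) • Measure.dirac x

/-! ### Infinite traces -/

/-- Sequences of traces that are non-decreasing for left divisibility. -/
structure NDSeq (R : α → α → Prop) where
  seq : ℕ → TraceMonoid R
  mono : ∀ n, seq n ∣ seq (n + 1)

/-- The preorder on non-decreasing sequences. -/
instance : Preorder (NDSeq R) where
  le s t := ∀ n, ∃ k, s.seq n ∣ t.seq k
  le_refl _ n := ⟨n, dvd_rfl⟩
  le_trans _ _ _ h₁ h₂ n :=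
    let ⟨k, hk⟩ := h₁ n
    let ⟨m, hm⟩ := h₂ k
    ⟨m, hk.trans hm⟩

/-- Generalized traces: classes of non-decreasing sequences, with the induced partial order. -/
abbrev GenTrace (R : α → α → Prop) : Type u :=
  Antisymmetrization (NDSeq R) (· ≤ ·)

/-- The class of a non-decreasing sequence, which is its least upper bound. -/
def GenTrace.lim (s : NDSeq R) : GenTrace R := toAntisymmetrization (· ≤ ·) s

/-- A trace seen as a generalized trace, through the constant sequence. -/
def GenTrace.ofTrace (x : TraceMonoid R) : GenTrace R := GenTrace.lim ⟨fun _ => x, fun _ => dvd_rfl⟩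

/-- The boundary: generalized traces that are not traces. -/
def Boundary (R : α → α → Prop) : Type u :=
  {ξ : GenTrace R // ξ ∉ Set.range (GenTrace.ofTrace (R := R))}

/-- The visual cylinder of base `x`. -/
def cylinder (x : TraceMonoid R) : Set (Boundary R) := {ξ | GenTrace.ofTrace x ≤ ξ.1}

/-- The σ-algebra of the boundary, generated by the (countably many) visual cylinders. -/
instance : MeasurableSpace (Boundary R) :=
  MeasurableSpace.generateFrom (Set.range (cylinder (R := R)))

/-- `m` is a uniform measure at infinity: a probability measure on the boundary with
`m(↑x) = p_Σ^|x|` for every trace `x`. -/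
structure IsUniformMeasure [Fintype α] (m : Measure (Boundary R)) : Prop where
  prob : IsProbabilityMeasure m
  apply_cylinder : ∀ x : TraceMonoid R, m (cylinder x) = pRoot R Finset.univ ^ len x

/-- `V_a(ξ) = v` for an infinite trace `ξ`: along a non-decreasing sequence with least upper
bound `ξ`, the traces `V_a(x_n)` are eventually defined and equal to `v`. -/
def IsVInf (a : α) (ξ : Boundary R) (v : TraceMonoid R) : Prop :=
  ∃ s : NDSeq R, GenTrace.lim s = ξ.1 ∧ ∃ q, ∀ n ≥ q, IsV a (s.seq n) v

open Classical in
/-- The map `V_a` on the boundary, with the value `1` (which is not pyramidal) where it is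
not defined. -/
def VInf (a : α) (ξ : Boundary R) : TraceMonoid R :=
  if h : ∃ v, IsVInf a ξ v then h.choose else 1

end TraceMonoid

end

noncomputable section

namespace TraceMonoid

variable {α : Type u} {R : α → α → Prop}

/-! ### Words, lengths and letters -/

/-! Everything rests on one identity: the weights `p_Σ^|v|` of the pyramidal traces `v` sum to 1
(`tsum_pyr`). By Cartier–Foata inversion (`mobius_mul_tsum`), the traces of `M_S` with no last
letter in `T ⊆ S` have generating series `μ_T / μ_S`. The pyramids are the `z * a` with `z` free of
`a` and ending only in letters linked to `a`, so their series is `1 - μ_Σ(t) / μ_{Σ∖a}(t)` for `t <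
p_{Σ∖a}`. At `t = p_Σ` this is 1, since `μ_Σ(p_Σ) = 0` (`eval_mobius_pRoot`), provided that `p_Σ <
p_{Σ∖a}` (`pRoot_univ_lt`). Connectedness gives this strict inequality: some pyramid contains all
letters and stays a pyramid after left multiplication by any trace without `a`, so the pyramid
series dominates a power of `t` times the series of `M_{Σ∖a}`.

The uniform measure is the law of an infinite product of independent pyramids with these weights.
The mass of `↑(u * x)`, with `u` a pyramid, factors through the first term of the product. For `z`
without `a`, decomposing along the pyramid that follows `z` exhibits the mass of `↑z` as a weighted
mean of itself and `p_Σ^|z|`, the latter with positive weight, which forces equality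
(`prodLaw_cylinder_of_count_eq_zero`). Uniqueness holds because cylinders form a π-system.

Finally, for a pyramid `v`, `V_a(ξ) = v` means `ξ ∈ ↑v`, of mass `p_Σ^|v|`, and the conditioned law
of `Z * a` gives `v` the same mass. As these masses already sum to 1, both laws live on the pyramids
and coincide. -/

theorem word_nil : word R [] = 1 := rfl

theorem word_cons (a : α) (w : List α) : word R (a :: w) = letter R a * word R w := rfl

theorem word_singleton (a : α) : word R [a] = letter R a := by
  rw [word_cons, word_nil, mul_one]

theorem word_append (v w : List α) : word R (v ++ w) = word R v * word R w := by
  induction v with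
  | nil => simp [word_nil]
  | cons a v ih => rw [List.cons_append, word_cons, word_cons, ih, mul_assoc]

theorem word_surjective : Function.Surjective (word R) := by
  intro x
  obtain ⟨w, hw⟩ := PresentedMonoid.surjective_mk (rels := TraceRel R) x
  exact ⟨FreeMonoid.toList w, by rw [← hw]; rfl⟩

theorem letter_mul_letter {a b : α} (h : ¬ R a b) :
    letter R a * letter R b = letter R b * letter R a :=
  PresentedMonoid.mk_eq_mk_of_rel (TraceRel.comm a b h)

/-- Induction on traces by multiplication by a letter on the left. -/
theorem induction_left {motive : TraceMonoid R → Prop} (one : motive 1)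
    (mul : ∀ a x, motive x → motive (letter R a * x)) (x : TraceMonoid R) : motive x := by
  obtain ⟨w, rfl⟩ := word_surjective x
  induction w with
  | nil => exact one
  | cons a w ih => exact mul a _ ih

/-- Induction on traces by multiplication by a letter on the right. -/
theorem induction_right {motive : TraceMonoid R → Prop} (one : motive 1)
    (mul : ∀ a x, motive x → motive (x * letter R a)) (x : TraceMonoid R) : motive x := by
  obtain ⟨w, rfl⟩ := word_surjective x
  induction w using List.reverseRecOn with
  | nil => exact one
  | append_singleton w a ih =>
    rw [word_append, word_singleton]
    exact mul a _ ih

theorem weight_letter (f : α → ℕ) (a : α) :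
    weight R f (letter R a) = Multiplicative.ofAdd (f a) := rfl

theorem len_one : len (1 : TraceMonoid R) = 0 := by simp [len]

theorem len_mul (x y : TraceMonoid R) : len (x * y) = len x + len y := by simp [len]

theorem len_letter (a : α) : len (letter R a) = 1 := by simp [len, weight_letter]

theorem len_word (w : List α) : len (word R w) = w.length := by
  induction w with
  | nil => simp [word_nil, len_one]
  | cons a w ih => rw [word_cons, len_mul, len_letter, ih, List.length_cons, add_comm]

theorem eq_one_of_len_eq_zero {x : TraceMonoid R} (h : len x = 0) : x = 1 := by
  obtain ⟨w, rfl⟩ := word_surjective x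
  rw [len_word, List.length_eq_zero_iff] at h
  rw [h, word_nil]

theorem count_one (a : α) : count a (1 : TraceMonoid R) = 0 := by simp [count]

theorem count_mul (a : α) (x y : TraceMonoid R) : count a (x * y) = count a x + count a y := by
  simp [count]

theorem count_letter_self (a : α) : count a (letter R a) = 1 := by simp [count, weight_letter]

theorem count_letter_of_ne {a b : α} (h : b ≠ a) : count a (letter R b) = 0 := by
  simp [count, weight_letter, h]

theorem count_letter_pos {a b : α} : 0 < count a (letter R b) ↔ b = a := by
  by_cases h : b = a
  · subst h; simp [count_letter_self]
  · simp [count_letter_of_ne h, h]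

theorem count_word_pos {a : α} {w : List α} : 0 < count a (word R w) ↔ a ∈ w := by
  induction w with
  | nil => simp [word_nil, count_one]
  | cons b w ih =>
    rw [word_cons, count_mul, List.mem_cons, ← ih, Nat.add_pos_iff_pos_or_pos, count_letter_pos,
      eq_comm]

theorem mem_sub_iff {S : Set α} {x : TraceMonoid R} :
    x ∈ sub R S ↔ ∀ b, 0 < count b x → b ∈ S := by
  constructor
  · intro hx
    refine Submonoid.closure_induction (motive := fun y _ => ∀ b, 0 < count b y → b ∈ S)
      ?_ ?_ ?_ hx
    · rintro _ ⟨c, hc, rfl⟩ b hb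
      rwa [← count_letter_pos.1 hb]
    · intro b hb
      simp [count_one] at hb
    · intro y z _ _ hy hz b hb
      rw [count_mul, Nat.add_pos_iff_pos_or_pos] at hb
      exact hb.elim (hy b) (hz b)
  · induction x using induction_left with
    | one => exact fun _ => Submonoid.one_mem _
    | mul a x ih =>
      intro h
      refine Submonoid.mul_mem _ (Submonoid.subset_closure ⟨a, h a ?_, rfl⟩) (ih fun b hb => h b ?_)
      · rw [count_mul, count_letter_self]; omega
      · rw [count_mul]; omega

theorem mul_mem_sub_iff {S : Set α} {x y : TraceMonoid R} :
    x * y ∈ sub R S ↔ x ∈ sub R S ∧ y ∈ sub R S := by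
  simp only [mem_sub_iff, count_mul, Nat.add_pos_iff_pos_or_pos]
  grind

theorem letter_mem_sub_iff {S : Set α} {b : α} : letter R b ∈ sub R S ↔ b ∈ S := by
  simp [mem_sub_iff, count_letter_pos]

/-! ### Reversal -/

/-- The reversal of traces, as a morphism to the opposite monoid. -/
def revHom (R : α → α → Prop) : TraceMonoid R →* (TraceMonoid R)ᵐᵒᵖ :=
  PresentedMonoid.lift (rels := TraceRel R) (fun b => MulOpposite.op (letter R b)) (by
    rintro _ _ ⟨a, b, h⟩
    simp [← MulOpposite.op_mul, letter_mul_letter h])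

/-- The reversal of a trace. -/
def rev (x : TraceMonoid R) : TraceMonoid R := (revHom R x).unop

theorem rev_one : rev (1 : TraceMonoid R) = 1 := by simp [rev]

theorem rev_mul (x y : TraceMonoid R) : rev (x * y) = rev y * rev x := by simp [rev]

theorem rev_letter (a : α) : rev (letter R a) = letter R a := rfl

theorem rev_rev (x : TraceMonoid R) : rev (rev x) = x := by
  induction x using induction_left with
  | one => simp [rev_one]
  | mul a x ih => rw [rev_mul, rev_mul, ih, rev_letter, rev_letter]

theorem count_rev (a : α) (x : TraceMonoid R) : count a (rev x) = count a x := by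
  induction x using induction_left with
  | one => simp [rev_one]
  | mul b x ih => rw [rev_mul, count_mul, count_mul, ih, rev_letter, add_comm]

/-! ### Division by a letter -/

open Classical in
/-- The action of a letter on pairs made of a trace and the quotient of this trace by `a`, when it
exists. -/
def quotStep (R : α → α → Prop) (a b : α) :
    Function.End (TraceMonoid R × Option (TraceMonoid R)) := fun q =>
  (letter R b * q.1,
    if b = a then some q.1 else if R a b then none else q.2.map (letter R b * ·))

theorem quotStep_comm (hs : ∀ a b, R a b → R b a) (a b c : α) (h : ¬ R b c) :
    quotStep R a b * quotStep R a c = quotStep R a c * quotStep R a b := by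
  funext ⟨x, o⟩
  have hbc : letter R b * (letter R c * x) = letter R c * (letter R b * x) := by
    rw [← mul_assoc, letter_mul_letter h, mul_assoc]
  have hcb : ¬ R c b := fun h' => h (hs _ _ h')
  change quotStep R a b (quotStep R a c (x, o)) = quotStep R a c (quotStep R a b (x, o))
  simp only [quotStep, hbc, Prod.mk.injEq, true_and]
  by_cases hb : b = a
  · subst hb
    by_cases hc : c = b
    · subst hc; simp
    · simp [hc, h]
  · by_cases hc : c = a
    · subst hc; simp [hb, hcb]
    · simp only [hb, hc, if_false]
      by_cases h1 : R a b <;> by_cases h2 : R a c <;> simp only [h1, h2, if_true, if_false,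
        Option.map_none]
      rw [Option.map_map, Option.map_map]
      congr 1
      funext y
      simp only [Function.comp]
      rw [← mul_assoc, letter_mul_letter h, mul_assoc]

/-- The morphism given by the action `quotStep` of the letters. -/
def quotHom (hs : ∀ a b, R a b → R b a) (a : α) :
    TraceMonoid R →* Function.End (TraceMonoid R × Option (TraceMonoid R)) :=
  PresentedMonoid.lift (rels := TraceRel R) (quotStep R a) (by
    rintro _ _ ⟨b, c, h⟩
    simpa using quotStep_comm hs a b c h)

theorem quotHom_letter_mul (hs : ∀ a b, R a b → R b a) (a b : α) (x : TraceMonoid R)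
    (q : TraceMonoid R × Option (TraceMonoid R)) :
    quotHom hs a (letter R b * x) q = quotStep R a b (quotHom hs a x q) := by
  rw [map_mul]
  rfl

/-- The trace is carried along in the action because it becomes the quotient when the new letter is
`a`. The start value is `(1, none)` since `a` does not divide `1`. -/
theorem quotHom_fst (hs : ∀ a b, R a b → R b a) (a : α) (x : TraceMonoid R) :
    (quotHom hs a x (1, none)).1 = x := by
  induction x using induction_left with
  | one => rw [map_one]; rfl
  | mul b x ih => rw [quotHom_letter_mul, quotStep, ih]

/-- The quotient of a trace by the letter `a` on the left, when it exists. -/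
def quot (hs : ∀ a b, R a b → R b a) (a : α) (x : TraceMonoid R) : Option (TraceMonoid R) :=
  (quotHom hs a x (1, none)).2

open Classical in
theorem quot_letter_mul (hs : ∀ a b, R a b → R b a) (a b : α) (x : TraceMonoid R) :
    quot hs a (letter R b * x) = if b = a then some x else
      if R a b then none else (quot hs a x).map (letter R b * ·) := by
  rw [quot, quotHom_letter_mul, quotStep, quotHom_fst]
  rfl

theorem quot_letter_mul_self (hs : ∀ a b, R a b → R b a) (a : α) (x : TraceMonoid R) :
    quot hs a (letter R a * x) = some x := by
  rw [quot_letter_mul, if_pos rfl]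

theorem letter_mul_left_cancel (hs : ∀ a b, R a b → R b a) {a : α} {x y : TraceMonoid R}
    (h : letter R a * x = letter R a * y) : x = y := by
  have := congrArg (quot hs a) h
  rwa [quot_letter_mul_self, quot_letter_mul_self, Option.some_inj] at this

theorem cancel_left (hs : ∀ a b, R a b → R b a) {z x y : TraceMonoid R}
    (h : z * x = z * y) : x = y := by
  induction z using induction_left with
  | one => simpa using h
  | mul a z ih =>
    rw [mul_assoc, mul_assoc] at h
    exact ih (letter_mul_left_cancel hs h)

theorem cancel_right (hs : ∀ a b, R a b → R b a) {z x y : TraceMonoid R}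
    (h : x * z = y * z) : x = y := by
  have h' := congrArg rev h
  rw [rev_mul, rev_mul] at h'
  rw [← rev_rev x, cancel_left hs h', rev_rev]

theorem eq_letter_mul_of_quot (hs : ∀ a b, R a b → R b a) {a : α} {x y : TraceMonoid R}
    (h : quot hs a x = some y) : x = letter R a * y := by
  induction x using induction_left generalizing y with
  | one =>
    rw [quot, map_one] at h
    exact absurd h (Option.some_ne_none y).symm
  | mul b x ih =>
    rw [quot_letter_mul] at h
    split_ifs at h with h1 h2
    · rw [← Option.some_inj.1 h, h1]
    · obtain ⟨z, hz, rfl⟩ := Option.map_eq_some_iff.1 h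
      rw [ih hz, ← mul_assoc, ← mul_assoc, letter_mul_letter h2]

theorem letter_dvd_letter_mul (hs : ∀ a b, R a b → R b a) {a b : α} (hab : b ≠ a)
    {x : TraceMonoid R} (h : letter R a ∣ letter R b * x) : ¬ R a b ∧ letter R a ∣ x := by
  obtain ⟨y, hy⟩ := h
  have h1 := quot_letter_mul hs a b x
  rw [hy, quot_letter_mul_self, if_neg hab] at h1
  split_ifs at h1 with h2
  obtain ⟨z, hz, -⟩ := Option.map_eq_some_iff.1 h1.symm
  exact ⟨h2, z, eq_letter_mul_of_quot hs hz⟩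

/-- The letter `a` is unrelated to all the letters of the trace `y`. -/
def Indep (a : α) (y : TraceMonoid R) : Prop := ∀ b, 0 < count b y → ¬ R a b

theorem Indep.of_mul {a : α} {x y : TraceMonoid R} (h : Indep a (x * y)) :
    Indep a x ∧ Indep a y := by
  constructor <;> intro b hb <;> refine h b ?_ <;> rw [count_mul] <;> omega

theorem Indep.mul {a : α} {x y : TraceMonoid R} (hx : Indep a x) (hy : Indep a y) :
    Indep a (x * y) := by
  intro b hb
  rw [count_mul, Nat.add_pos_iff_pos_or_pos] at hb
  exact hb.elim (hx b) (hy b)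

theorem indep_letter {a b : α} : Indep a (letter R b) ↔ ¬ R a b := by
  simp [Indep, count_letter_pos]

theorem indep_rev {a : α} {x : TraceMonoid R} : Indep a (rev x) ↔ Indep a x := by
  simp [Indep, count_rev]

theorem Indep.comm {a : α} {y : TraceMonoid R} (h : Indep a y) :
    letter R a * y = y * letter R a := by
  induction y using induction_left with
  | one => simp
  | mul b y ih =>
    rw [← mul_assoc, letter_mul_letter (indep_letter.1 h.of_mul.1), mul_assoc, ih h.of_mul.2,
      mul_assoc]

/-- An initial `a` of the product that does not come from `y` must be moved across the whole of `y`.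
-/
theorem letter_dvd_mul (hs : ∀ a b, R a b → R b a) {a : α} {y n : TraceMonoid R}
    (h : letter R a ∣ y * n) : letter R a ∣ y ∨ (Indep a y ∧ letter R a ∣ n) := by
  induction y using induction_left with
  | one => exact Or.inr ⟨fun b hb => by simp [count_one] at hb, by simpa using h⟩
  | mul b y ih =>
    by_cases hb : b = a
    · exact Or.inl ⟨y, by rw [hb]⟩
    · rw [mul_assoc] at h
      obtain ⟨h1, h2⟩ := letter_dvd_letter_mul hs hb h
      refine (ih h2).imp ?_ fun h3 => ⟨(indep_letter.2 h1).mul h3.1, h3.2⟩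
      rintro ⟨z, rfl⟩
      exact ⟨letter R b * z, by rw [← mul_assoc, ← mul_assoc, letter_mul_letter h1]⟩

/-- Quotients of traces: `y` divides `x * m` if and only if a certain trace divides `m`, unless `x`
and `y` have no common multiple. -/
theorem exists_residual (hs : ∀ a b, R a b → R b a) (x y : TraceMonoid R) :
    (∃ r, ∀ m, y ∣ x * m ↔ r ∣ m) ∨ ∀ m, ¬ y ∣ x * m := by
  induction x using induction_left generalizing y with
  | one => exact Or.inl ⟨y, fun m => by rw [one_mul]⟩
  | mul a x ih =>
    -- One letter at a time: an initial `a` of `y` cancels; an `a` independent of `y` passes through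
    -- it and leaves `y` as residual; otherwise there is no common multiple.
    have key : (∃ r, ∀ m, y ∣ letter R a * m ↔ r ∣ m) ∨ ∀ m, ¬ y ∣ letter R a * m := by
      by_cases h : letter R a ∣ y
      · obtain ⟨y', rfl⟩ := h
        refine Or.inl ⟨y', fun m => ⟨?_, fun h => mul_dvd_mul_left _ h⟩⟩
        rintro ⟨n, hn⟩
        exact ⟨n, letter_mul_left_cancel hs (by rw [hn, mul_assoc])⟩
      · by_cases hi : Indep a y
        · refine Or.inl ⟨y, fun m => ⟨?_, ?_⟩⟩
          · rintro ⟨n, hn⟩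
            obtain ⟨-, n', rfl⟩ :=
              (letter_dvd_mul hs (Dvd.intro m hn)).resolve_left h
            exact ⟨n', letter_mul_left_cancel hs (by rw [hn, ← mul_assoc, ← mul_assoc, hi.comm])⟩
          · rintro ⟨n, rfl⟩
            exact ⟨letter R a * n, by rw [← mul_assoc, ← mul_assoc, hi.comm]⟩
        · refine Or.inr fun m => ?_
          rintro ⟨n, hn⟩
          exact hi ((letter_dvd_mul hs (Dvd.intro m hn)).resolve_left h).1
    obtain ⟨r, hr⟩ | hr := key
    · simp only [mul_assoc, hr]
      exact ih r
    · exact Or.inr fun m => by rw [mul_assoc]; exact hr _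

/-! ### Last letters -/

/-- The letter `c` divides the trace `x` on the right. -/
def EndsWith (c : α) (x : TraceMonoid R) : Prop := ∃ y, x = y * letter R c

theorem endsWith_iff_rev {c : α} {x : TraceMonoid R} : EndsWith c x ↔ letter R c ∣ rev x := by
  constructor
  · rintro ⟨y, rfl⟩
    exact ⟨rev y, by rw [rev_mul, rev_letter]⟩
  · rintro ⟨y, hy⟩
    exact ⟨rev y, by rw [← rev_rev x, hy, rev_mul, rev_letter]⟩

theorem EndsWith.mul_left {c : α} {x : TraceMonoid R} (h : EndsWith c x) (y : TraceMonoid R) :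
    EndsWith c (y * x) := by
  obtain ⟨z, rfl⟩ := h
  exact ⟨y * z, (mul_assoc _ _ _).symm⟩

theorem endsWith_mul_letter (c : α) (x : TraceMonoid R) : EndsWith c (x * letter R c) := ⟨x, rfl⟩

theorem EndsWith.mul_of_indep {c : α} {x y : TraceMonoid R} (h : EndsWith c x) (hy : Indep c y) :
    EndsWith c (x * y) := by
  obtain ⟨z, rfl⟩ := h
  exact ⟨z * y, by rw [mul_assoc, hy.comm, mul_assoc]⟩

theorem EndsWith.of_mul (hs : ∀ a b, R a b → R b a) {c : α} {x y : TraceMonoid R}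
    (h : EndsWith c (x * y)) : EndsWith c y ∨ (Indep c y ∧ EndsWith c x) := by
  rw [endsWith_iff_rev, rev_mul] at h
  simpa only [endsWith_iff_rev, indep_rev] using letter_dvd_mul hs h

theorem EndsWith.count_pos {c : α} {x : TraceMonoid R} (h : EndsWith c x) : 0 < count c x := by
  obtain ⟨z, rfl⟩ := h
  rw [count_mul, count_letter_self]
  omega

theorem not_endsWith_one (c : α) : ¬ EndsWith c (1 : TraceMonoid R) := fun h => by
  simpa [count_one] using h.count_pos

theorem endsWith_letter {b c : α} : EndsWith c (letter R b) ↔ b = c :=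
  ⟨fun h => count_letter_pos.1 h.count_pos, fun h => ⟨1, by rw [h, one_mul]⟩⟩

theorem exists_endsWith {x : TraceMonoid R} (h : x ≠ 1) : ∃ c, EndsWith c x := by
  induction x using induction_right with
  | one => exact absurd rfl h
  | mul a x _ => exact ⟨a, x, rfl⟩

/-! ### Pyramidal traces -/

/-- The trace `v` has exactly one occurrence of `a`, and `a` is its unique last letter. -/
structure IsPyramid (a : α) (v : TraceMonoid R) : Prop where
  endsWith : EndsWith a v
  count_eq : count a v = 1
  eq_of_endsWith : ∀ c, EndsWith c v → c = a

theorem isPyramid_letter (a : α) : IsPyramid a (letter R a) :=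
  ⟨⟨1, (one_mul _).symm⟩, count_letter_self a, fun _ h => (endsWith_letter.1 h).symm⟩

theorem IsPyramid.ne_one {a : α} {v : TraceMonoid R} (h : IsPyramid a v) : v ≠ 1 := by
  rintro rfl
  exact not_endsWith_one a h.endsWith

/-- A new first letter can be a last letter only if it is independent of `v`. This is the step by
which all pyramids below are grown. -/
theorem IsPyramid.letter_mul (hs : ∀ a b, R a b → R b a) {a b : α} (hb : b ≠ a)
    {v : TraceMonoid R} (hv : IsPyramid a v) (h : ¬ Indep b v) : IsPyramid a (letter R b * v) := by
  refine ⟨hv.endsWith.mul_left _, ?_, fun c hc => ?_⟩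
  · rw [count_mul, count_letter_of_ne hb, hv.count_eq]
  · obtain h1 | ⟨h1, h2⟩ := hc.of_mul hs
    · exact hv.eq_of_endsWith c h1
    · rw [endsWith_letter.1 h2] at h
      exact absurd h1 h

/-- Peel last letters off the cofactor of `v`. Such a letter either cancels in the cofactor `s` of
`v'`, or is a last letter of `v'`, hence `a`, and independent of `s`; but counting `a` shows that
`a` occurs in `s`, against reflexivity. -/
theorem IsPyramid.unique (hr : ∀ a, R a a) (hs : ∀ a b, R a b → R b a) {a : α}
    {v v' x : TraceMonoid R} (hv : IsPyramid a v) (hv' : IsPyramid a v') (h : v ∣ x)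
    (h' : v' ∣ x) : v = v' := by
  obtain ⟨r, rfl⟩ := h
  obtain ⟨s, hrs⟩ := h'
  induction r using induction_right generalizing s with
  | one =>
    by_cases hs1 : s = 1
    · rw [mul_one, hs1, mul_one] at hrs
      exact hrs
    · obtain ⟨c, hc⟩ := exists_endsWith hs1
      rw [mul_one] at hrs
      have h1 : EndsWith c v := hrs ▸ hc.mul_left _
      have h2 := hc.count_pos
      rw [hv.eq_of_endsWith c h1] at h2
      have h3 := hv.count_eq
      rw [hrs, count_mul, hv'.count_eq] at h3
      omega
  | mul c r ih =>
    rw [← mul_assoc] at hrs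
    have h1 : EndsWith c (v' * s) := ⟨_, hrs.symm⟩
    obtain ⟨s', rfl⟩ | ⟨h2, h3⟩ := h1.of_mul hs
    · rw [← mul_assoc] at hrs
      exact ih s' (cancel_right hs hrs)
    · have hc := hv'.eq_of_endsWith c h3
      subst hc
      have h4 := congrArg (count c) hrs
      rw [count_mul, count_mul, count_mul, hv.count_eq, hv'.count_eq, count_letter_self] at h4
      exact absurd (hr c) (h2 c (by omega))

/-- A pyramidal trace multiplied on the left by a trace `z` without occurrence of the summit: the
part of `z` which is not below the summit can be moved to the right. -/
theorem IsPyramid.exists_split (hs : ∀ a b, R a b → R b a) {a : α} {v z : TraceMonoid R}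
    (hv : IsPyramid a v) (hz : count a z = 0) :
    ∃ y z', z = y * z' ∧ IsPyramid a (y * v) ∧ z' * v = v * z' := by
  induction z using induction_left with
  | one => exact ⟨1, 1, by simp, by simpa using hv, by simp⟩
  | mul b z ih =>
    rw [count_mul] at hz
    obtain ⟨y, z', rfl, h1, h2⟩ := ih (by omega)
    have hb : b ≠ a := by
      rintro rfl
      rw [count_letter_self] at hz
      omega
    by_cases hi : Indep b (y * v)
    · refine ⟨y, letter R b * z', ?_, h1, ?_⟩
      · rw [← mul_assoc, hi.of_mul.1.comm, mul_assoc]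
      · rw [mul_assoc, h2, ← mul_assoc, hi.of_mul.2.comm, mul_assoc]
    · exact ⟨letter R b * y, z', by rw [mul_assoc],
        by rw [mul_assoc]; exact h1.letter_mul hs hb hi, h2⟩

/-- Reading from the right, each new letter is either absorbed into the current pyramid or commutes
past it. -/
theorem exists_isPyramid_dvd (hs : ∀ a b, R a b → R b a) {a : α} {x : TraceMonoid R}
    (hx : 0 < count a x) : ∃ v, IsPyramid a v ∧ v ∣ x := by
  induction x using induction_left with
  | one => simp [count_one] at hx
  | mul b x ih =>
    by_cases hb : b = a
    · exact ⟨letter R b, hb ▸ isPyramid_letter a, x, rfl⟩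
    · rw [count_mul, count_letter_of_ne hb, zero_add] at hx
      obtain ⟨v, hv, n, rfl⟩ := ih hx
      by_cases hi : Indep b v
      · exact ⟨v, hv, letter R b * n, by rw [← mul_assoc, hi.comm, mul_assoc]⟩
      · exact ⟨letter R b * v, hv.letter_mul hs hb hi, n, by rw [mul_assoc]⟩

/-- If the dependence graph is connected, there is a pyramidal trace that contains every letter. -/
theorem exists_isPyramid_full [Fintype α] (hs : ∀ a b, R a b → R b a)
    (hirr : (SimpleGraph.fromRel R).Connected) (a : α) :
    ∃ v : TraceMonoid R, IsPyramid a v ∧ ∀ b, 0 < count b v := by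
  classical
  -- Follow a path of the graph from `a` to `b`: each vertex is related to its predecessor, which
  -- already occurs, so it can be put in front.
  have step : ∀ b, ∀ v : TraceMonoid R, IsPyramid a v →
      ∃ y : TraceMonoid R, IsPyramid a (y * v) ∧ 0 < count b (y * v) := by
    intro b v hv
    have hreach := (SimpleGraph.reachable_iff_reflTransGen a b).1 (hirr.preconnected a b)
    induction hreach with
    | refl => exact ⟨1, by simpa using hv, by simp [hv.count_eq]⟩
    | @tail c d _ hcd ih =>
      obtain ⟨y, h1, h2⟩ := ih
      -- A path that returns to `a` is restarted from `v`, because a pyramid must not receive a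
      -- second `a`.
      by_cases hd : d = a
      · subst hd
        exact ⟨1, by simpa using hv, by simp [hv.count_eq]⟩
      · have hR : R d c := by
          have := hcd.2
          exact this.elim (hs _ _) id
        refine ⟨letter R d * y, ?_, ?_⟩
        · rw [mul_assoc]
          exact h1.letter_mul hs hd fun hi => hi c h2 hR
        · rw [mul_assoc, count_mul, count_letter_self]
          omega
  have all : ∀ T : Finset α, ∃ v : TraceMonoid R, IsPyramid a v ∧ ∀ b ∈ T, 0 < count b v := by
    intro T
    induction T using Finset.induction_on with
    | empty => exact ⟨letter R a, isPyramid_letter a, by simp⟩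
    | insert b T _ ih =>
      obtain ⟨v, hv, hT⟩ := ih
      obtain ⟨y, h1, h2⟩ := step b v hv
      refine ⟨y * v, h1, fun c hc => ?_⟩
      obtain rfl | hc := Finset.mem_insert.1 hc
      · exact h2
      · rw [count_mul]
        have := hT c hc
        omega
  obtain ⟨v, hv, h⟩ := all Finset.univ
  exact ⟨v, hv, fun b => h b (Finset.mem_univ b)⟩

/-- By reflexivity, no letter is independent of a trace in which all letters occur. -/
theorem IsPyramid.mul_of_full (hr : ∀ a, R a a) (hs : ∀ a b, R a b → R b a) {a : α}
    {v z : TraceMonoid R} (hv : IsPyramid a v) (hfull : ∀ b, 0 < count b v)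
    (hz : count a z = 0) : IsPyramid a (z * v) := by
  induction z using induction_left with
  | one => simpa using hv
  | mul b z ih =>
    rw [count_mul] at hz
    have hb : b ≠ a := by
      rintro rfl
      rw [count_letter_self] at hz
      omega
    rw [mul_assoc]
    exact (ih (by omega)).letter_mul hs hb fun hi => hi.of_mul.2 b (hfull b) (hr b)


/-! ### Heaps of words -/

theorem HeapLE.le {w : List α} {i j : Fin w.length} (h : HeapLE R w i j) : i ≤ j := by
  induction h with
  | refl => exact le_rfl
  | tail _ h ih => exact ih.trans h.1

theorem heapLE_succ_succ {b : α} {w : List α} {i j : Fin w.length} :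
    HeapLE R (b :: w) i.succ j.succ ↔ HeapLE R w i j := by
  constructor
  · have key : ∀ k : Fin (b :: w).length, HeapLE R (b :: w) i.succ k →
        ∀ j : Fin w.length, k = j.succ → HeapLE R w i j := by
      intro k hk
      induction hk with
      | refl =>
        intro j hj
        rw [Fin.succ_inj.1 hj]
        exact Relation.ReflTransGen.refl
      | @tail k l hk hkl ih =>
        rintro j rfl
        have hk0 : k ≠ 0 := by
          rintro rfl
          exact absurd (HeapLE.le hk) (by simp)
        obtain ⟨k', rfl⟩ := Fin.exists_succ_eq.2 hk0
        exact (ih k' rfl).tail ⟨Fin.succ_le_succ_iff.1 hkl.1, hkl.2⟩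
    exact fun h => key _ h j rfl
  · intro h
    induction h with
    | refl => exact Relation.ReflTransGen.refl
    | tail _ hkl ih => exact ih.tail ⟨Fin.succ_le_succ_iff.2 hkl.1, hkl.2⟩

theorem heapLE_zero_succ {b : α} {w : List α} {i : Fin w.length} :
    HeapLE R (b :: w) (0 : Fin (w.length + 1)) i.succ ↔ ∃ j, R b (w.get j) ∧ HeapLE R w j i := by
  constructor
  · have key : ∀ k : Fin (b :: w).length, HeapLE R (b :: w) (0 : Fin (w.length + 1)) k →
        ∀ i : Fin w.length, k = i.succ → ∃ j, R b (w.get j) ∧ HeapLE R w j i := by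
      intro k hk
      induction hk with
      | refl => intro i hi; exact absurd hi.symm (Fin.succ_ne_zero i)
      | @tail k l hk hkl ih =>
        rintro i rfl
        by_cases hk0 : k = (0 : Fin (w.length + 1))
        · subst hk0
          exact ⟨i, hkl.2, Relation.ReflTransGen.refl⟩
        · obtain ⟨k', rfl⟩ := Fin.exists_succ_eq.2 hk0
          obtain ⟨j, h1, h2⟩ := ih k' rfl
          exact ⟨j, h1, h2.tail ⟨Fin.succ_le_succ_iff.1 hkl.1, hkl.2⟩⟩
    exact fun h => key _ h i rfl
  · rintro ⟨j, h1, h2⟩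
    exact Relation.ReflTransGen.head (b := j.succ) ⟨Fin.zero_le _, h1⟩ (heapLE_succ_succ.2 h2)

theorem mem_belowWord {w : List α} {i : Fin w.length} {c : α} :
    c ∈ belowWord R w i ↔ ∃ j, w.get j = c ∧ HeapLE R w j i := by
  simp only [belowWord, List.mem_map, List.mem_filter, List.mem_finRange, true_and,
    decide_eq_true_eq]
  exact exists_congr fun j => and_comm

theorem belowWord_zero (b : α) (w : List α) :
    belowWord R (b :: w) (0 : Fin (w.length + 1)) = [b] := by
  have h : ∀ j : Fin w.length, ¬ HeapLE R (b :: w) j.succ (0 : Fin (w.length + 1)) := fun j hj =>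
    absurd hj.le (by simp)
  have h0 : HeapLE R (b :: w) (0 : Fin (w.length + 1)) (0 : Fin (w.length + 1)) :=
    Relation.ReflTransGen.refl
  simp only [belowWord, List.length_cons, List.finRange_succ]
  rw [List.filter_cons_of_pos (by simpa using h0), List.filter_eq_nil_iff.2]
  · rfl
  · intro k hk
    obtain ⟨j, -, rfl⟩ := List.mem_map.1 hk
    simpa using h j

open Classical in
-- This is the absorb-or-commute recursion of `exists_isPyramid_dvd` at the level of words; it
-- connects heaps with pyramids.
theorem belowWord_succ (b : α) (w : List α) (i : Fin w.length) :
    belowWord R (b :: w) i.succ =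
      if ∃ c ∈ belowWord R w i, R b c then b :: belowWord R w i else belowWord R w i := by
  have h : ((List.finRange w.length).map Fin.succ).filter
      (fun j => decide (HeapLE R (b :: w) j i.succ)) =
      ((List.finRange w.length).filter fun j => decide (HeapLE R w j i)).map Fin.succ := by
    rw [List.filter_map]
    congr 2
    funext j
    simp only [Function.comp]
    exact decide_eq_decide.2 heapLE_succ_succ
  have h0 : (∃ c ∈ belowWord R w i, R b c) ↔
      HeapLE R (b :: w) (0 : Fin (w.length + 1)) i.succ := by
    rw [heapLE_zero_succ]
    simp only [mem_belowWord]
    grind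
  have hm : (((List.finRange w.length).filter fun j => decide (HeapLE R w j i)).map Fin.succ).map
      (b :: w).get = belowWord R w i := by
    rw [List.map_map]
    rfl
  rw [if_congr h0 rfl rfl]
  simp only [belowWord, List.length_cons, List.finRange_succ]
  split_ifs with h1
  · rw [List.filter_cons_of_pos (by simpa using h1)]
    refine (congrArg (fun l => ((0 : Fin (w.length + 1)) :: l).map (b :: w).get) h).trans ?_
    exact congrArg (b :: ·) hm
  · rw [List.filter_cons_of_neg (by simpa using h1)]
    exact (congrArg (List.map (b :: w).get) h).trans hm

theorem indep_word {b : α} {w : List α} : Indep b (word R w) ↔ ∀ c ∈ w, ¬ R b c := by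
  simp [Indep, count_word_pos]

theorem word_belowWord_dvd (w : List α) (i : Fin w.length) :
    word R (belowWord R w i) ∣ word R w := by
  classical
  induction w with
  | nil => exact i.elim0
  | cons b w ih =>
    induction i using Fin.cases with
    | zero => exact ⟨word R w, by rw [belowWord_zero, word_singleton, word_cons]⟩
    | succ i =>
      rw [belowWord_succ]
      obtain ⟨n, hn⟩ := ih i
      split_ifs with h
      · exact ⟨n, by rw [word_cons, word_cons, hn, mul_assoc]⟩
      · have hi : Indep b (word R (belowWord R w i)) := by
          rw [indep_word]
          grind
        exact ⟨letter R b * n, by rw [word_cons, hn, ← mul_assoc, hi.comm, mul_assoc]⟩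

theorem isPyramid_belowWord (hs : ∀ a b, R a b → R b a) (w : List α) (i : Fin w.length)
    (h : ∀ j, w.get j = w.get i → i ≤ j) : IsPyramid (w.get i) (word R (belowWord R w i)) := by
  classical
  induction w with
  | nil => exact i.elim0
  | cons b w ih =>
    induction i using Fin.cases with
    | zero =>
      rw [belowWord_zero, word_singleton]
      exact isPyramid_letter b
    | succ i =>
      have hi : IsPyramid (w.get i) (word R (belowWord R w i)) :=
        ih i fun j hj => Fin.succ_le_succ_iff.1 (h j.succ hj)
      have hb : b ≠ w.get i := fun hb => absurd (h (0 : Fin (w.length + 1)) hb) (by simp)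
      rw [belowWord_succ]
      split_ifs with h1
      · rw [word_cons]
        refine hi.letter_mul hs hb ?_
        rw [indep_word]
        grind
      · exact hi

/-- Replaces heaps by divisibility. Existence comes from the first position labelled `a`, which by
reflexivity lies below all the others with this label; `IsPyramid.unique` identifies the value. -/
theorem isV_iff (hr : ∀ a, R a a) (hs : ∀ a b, R a b → R b a) {a : α} {x y : TraceMonoid R} :
    IsV a x y ↔ IsPyramid a y ∧ y ∣ x := by
  classical
  constructor
  · rintro ⟨w, rfl, i, rfl, h, rfl⟩
    exact ⟨isPyramid_belowWord hs w i fun j hj => (h j hj).le, word_belowWord_dvd w i⟩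
  · rintro ⟨hy, hyx⟩
    obtain ⟨w, rfl⟩ := word_surjective x
    have ha : a ∈ w := by
      obtain ⟨n, hn⟩ := hyx
      rw [← count_word_pos (R := R), hn, count_mul, hy.count_eq]
      omega
    obtain ⟨i₀, hi₀⟩ := List.get_of_mem ha
    obtain ⟨i, hi, hlt⟩ := wellFounded_lt.has_min {j : Fin w.length | w.get j = a} ⟨i₀, hi₀⟩
    have hmin : ∀ j, w.get j = a → i ≤ j := fun j hj => not_lt.1 (hlt j hj)
    refine ⟨w, rfl, i, hi, fun j hj => Relation.ReflTransGen.single ⟨hmin j hj, ?_⟩, ?_⟩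
    · rw [hj, show w.get i = a from hi]
      exact hr a
    · have hp := isPyramid_belowWord hs w i (fun j hj => hmin j (hj.trans hi))
      rw [show w.get i = a from hi] at hp
      exact hy.unique hr hs hp hyx (word_belowWord_dvd w i)

theorem mem_pyr_iff (hr : ∀ a, R a a) (hs : ∀ a b, R a b → R b a) {a : α} {v : TraceMonoid R} :
    v ∈ Pyr R a ↔ IsPyramid a v := by
  constructor
  · rintro ⟨x, -, h⟩
    exact ((isV_iff hr hs).1 h).1
  · intro h
    exact ⟨v, by rw [h.count_eq]; omega, (isV_iff hr hs).2 ⟨h, dvd_rfl⟩⟩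

theorem endsWith_of_maximal (w : List α) (i : Fin w.length)
    (h : ∀ j, HeapLE R w i j → j = i) : EndsWith (w.get i) (word R w) := by
  induction w with
  | nil => exact i.elim0
  | cons b w ih =>
    rw [word_cons]
    induction i using Fin.cases with
    | zero =>
      refine (endsWith_letter.2 rfl).mul_of_indep ?_
      rw [indep_word]
      intro c hc hbc
      obtain ⟨j, rfl⟩ := List.get_of_mem hc
      exact absurd (h j.succ (Relation.ReflTransGen.single ⟨Fin.zero_le _, hbc⟩))
        (Fin.succ_ne_zero j)
    | succ i =>
      exact (ih i fun j hj => Fin.succ_inj.1 (h j.succ (heapLE_succ_succ.2 hj))).mul_left _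

theorem maxIn_iff {U : Set α} {x : TraceMonoid R} : MaxIn U x ↔ ∀ c, EndsWith c x → c ∈ U := by
  constructor
  · rintro h c ⟨y, rfl⟩
    obtain ⟨w, rfl⟩ := word_surjective y
    have hl : w.length < (w ++ [c]).length := by simp
    -- In a word that ends with `c` the last position is maximal, as the heap order is contained in
    -- the order of positions.
    have := h (w ++ [c]) (by rw [word_append, word_singleton]) ⟨w.length, hl⟩ fun j hj => by
      have h1 : w.length ≤ j := hj.le
      have h2 := j.2
      simp only [List.length_append, List.length_singleton] at h2
      exact Fin.ext (by simp only; omega)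
    simpa using this
  · rintro h w rfl i hi
    exact h _ (endsWith_of_maximal w i hi)

/-- The pyramidal traces of summit `a` are the traces `z * a` where `a` does not occur in `z` and
the maximal letters of `z` are linked to `a`. -/
theorem isPyramid_mul_letter (hr : ∀ a, R a a) (hs : ∀ a b, R a b → R b a) {a : α}
    {z : TraceMonoid R} :
    IsPyramid a (z * letter R a) ↔ count a z = 0 ∧ MaxIn (link R a) z := by
  rw [maxIn_iff]
  constructor
  · intro h
    have h1 := h.count_eq
    rw [count_mul, count_letter_self] at h1
    refine ⟨by omega, fun c hc => ?_⟩
    by_contra hcon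
    have h2 : EndsWith c (z * letter R a) :=
      hc.mul_of_indep (indep_letter.2 fun hca => hcon (hs _ _ hca))
    rw [h.eq_of_endsWith c h2] at hcon
    exact hcon (hr a)
  · rintro ⟨h1, h2⟩
    refine ⟨endsWith_mul_letter a z, by rw [count_mul, h1, count_letter_self], fun c hc => ?_⟩
    obtain h3 | ⟨h3, h4⟩ := hc.of_mul hs
    · exact (endsWith_letter.1 h3).symm
    · exact absurd (hs _ _ (h2 c h4)) (indep_letter.1 h3)


/-! ### Möbius polynomials -/

open Classical in
-- Split the commuting sets according to whether they contain `b`; those that do are `b` added to a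
-- commuting set of letters that commute with `b`.
theorem mobius_insert (hs : ∀ a b, R a b → R b a) {b : α} {T : Finset α} (hb : b ∉ T) :
    mobius R (insert b T) =
      mobius R T - Polynomial.X * mobius R (T.filter fun c => ¬ R b c) := by
  have hset : T.powerset.filter
      (fun γ : Finset α => ((insert b γ : Finset α) : Set α).Pairwise fun a b => ¬ R a b) =
      (T.filter fun c => ¬ R b c).powerset.filter
        (fun γ : Finset α => (γ : Set α).Pairwise fun a b => ¬ R a b) := by
    ext γ
    simp only [Finset.mem_filter, Finset.mem_powerset, Finset.coe_insert]
    constructor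
    · rintro ⟨h1, h2⟩
      refine ⟨fun c hc => Finset.mem_filter.2 ⟨h1 hc, ?_⟩, h2.mono (Set.subset_insert _ _)⟩
      refine h2 (Set.mem_insert _ _) (Set.mem_insert_of_mem _ hc) ?_
      rintro rfl
      exact hb (h1 hc)
    · rintro ⟨h1, h2⟩
      refine ⟨fun c hc => (Finset.mem_filter.1 (h1 hc)).1, ?_⟩
      rw [Set.pairwise_insert]
      refine ⟨h2, fun c hc _ => ?_⟩
      have h3 := (Finset.mem_filter.1 (h1 hc)).2
      exact ⟨h3, fun h4 => h3 (hs _ _ h4)⟩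
  have hcard : ∀ γ ∈ T.powerset.filter
      (fun γ : Finset α => ((insert b γ : Finset α) : Set α).Pairwise fun a b => ¬ R a b),
      (-Polynomial.X : Polynomial ℝ) ^ (insert b γ).card =
        -Polynomial.X * (-Polynomial.X) ^ γ.card := by
    intro γ hγ
    rw [Finset.card_insert_of_notMem
      (fun h => hb (Finset.mem_powerset.1 (Finset.mem_filter.1 hγ).1 h)), pow_succ']
  have hsum := Finset.sum_congr rfl hcard
  rw [← Finset.mul_sum] at hsum
  conv_rhs at hsum => rw [hset]
  rw [Finset.sum_filter] at hsum
  simp only [mobius]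
  rw [Finset.sum_filter, Finset.sum_powerset_insert hb, sub_eq_add_neg, ← neg_mul]
  congr 1
  rw [Finset.sum_filter]

theorem mobius_empty : mobius R (∅ : Finset α) = 1 := by
  classical
  rw [mobius, Finset.powerset_empty, Finset.filter_true_of_mem]
  · simp
  · intro γ hγ
    rw [Finset.mem_singleton.1 hγ]
    simp

/-! ### Generating functions -/

/-- The traces of `M_S` with no last letter in `T`. -/
def avoiding (R : α → α → Prop) (S : Set α) (T : Finset α) : Set (TraceMonoid R) :=
  {x | x ∈ sub R S ∧ ∀ c ∈ T, ¬ EndsWith c x}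

theorem summable_pow_len {𝕜 : Type*} [RCLike 𝕜] {t : 𝕜} {S : Set α}
    (h : Summable fun x : sub R S => ‖t‖ ^ len (x : TraceMonoid R)) {A : Set (TraceMonoid R)}
    (hA : A ⊆ sub R S) : Summable fun x : A => t ^ len (x : TraceMonoid R) := by
  refine Summable.of_norm ?_
  simp only [norm_pow]
  exact h.comp_injective (i := fun x : A => (⟨x, hA x.2⟩ : sub R S))
    fun x y hxy => Subtype.ext (congrArg (fun z : sub R S => (z : TraceMonoid R)) hxy)

theorem avoiding_subset {S : Set α} {T : Finset α} : avoiding R S T ⊆ sub R S := fun _ h => h.1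

open Classical in
-- The counterpart of `mobius_insert` for series. The traces that are removed are the `z * b`;
-- appending `b` hides the last letters related to `b`, so `z` has to avoid only the letters of `T`
-- that commute with `b`.
theorem tsum_avoiding_insert (hs : ∀ a b, R a b → R b a)
    {𝕜 : Type*} [RCLike 𝕜] {t : 𝕜} {S : Set α}
    (h : Summable fun x : sub R S => ‖t‖ ^ len (x : TraceMonoid R)) {b : α} {T : Finset α}
    (hb : b ∉ T) (hbS : b ∈ S) :
    ∑' x : avoiding R S (insert b T), t ^ len (x : TraceMonoid R) =
      ∑' x : avoiding R S T, t ^ len (x : TraceMonoid R) -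
        t * ∑' x : avoiding R S (T.filter fun c => ¬ R b c), t ^ len (x : TraceMonoid R) := by
  set B : Set (TraceMonoid R) :=
    (fun z => z * letter R b) '' avoiding R S (T.filter fun c => ¬ R b c) with hB
  have hunion : avoiding R S T = avoiding R S (insert b T) ∪ B := by
    ext x
    constructor
    · rintro ⟨h1, h2⟩
      by_cases hx : EndsWith b x
      · obtain ⟨z, rfl⟩ := hx
        refine Or.inr ⟨z, ⟨(mul_mem_sub_iff.1 h1).1, fun c hc hcz => ?_⟩, rfl⟩
        rw [Finset.mem_filter] at hc
        exact h2 c hc.1 (hcz.mul_of_indep (indep_letter.2 fun hcb => hc.2 (hs _ _ hcb)))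
      · refine Or.inl ⟨h1, fun c hc => ?_⟩
        obtain rfl | hc := Finset.mem_insert.1 hc
        · exact hx
        · exact h2 c hc
    · rintro (⟨h1, h2⟩ | ⟨z, ⟨h1, h2⟩, rfl⟩)
      · exact ⟨h1, fun c hc => h2 c (Finset.mem_insert_of_mem hc)⟩
      · refine ⟨mul_mem_sub_iff.2 ⟨h1, letter_mem_sub_iff.2 hbS⟩, fun c hc hcz => ?_⟩
        obtain h3 | ⟨h3, h4⟩ := hcz.of_mul hs
        · exact hb (endsWith_letter.1 h3 ▸ hc)
        · exact h2 c (Finset.mem_filter.2 ⟨hc, fun hbc => indep_letter.1 h3 (hs _ _ hbc)⟩) h4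
  have hdisj : Disjoint (avoiding R S (insert b T)) B := by
    rw [Set.disjoint_left]
    rintro _ h1 ⟨z, -, rfl⟩
    exact h1.2 b (Finset.mem_insert_self _ _) (endsWith_mul_letter b z)
  have hBS : B ⊆ sub R S := fun x hx => (hunion ▸ Or.inr hx : x ∈ avoiding R S T).1
  have hsum : ∑' x : B, t ^ len (x : TraceMonoid R) =
      t * ∑' x : avoiding R S (T.filter fun c => ¬ R b c), t ^ len (x : TraceMonoid R) := by
    rw [hB, tsum_image (f := fun x : TraceMonoid R => t ^ len x)
      (fun x _ y _ hxy => cancel_right hs hxy), ← tsum_mul_left]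
    refine tsum_congr fun x => ?_
    rw [len_mul, len_letter, pow_succ']
  rw [eq_sub_iff_add_eq, ← hsum, hunion]
  exact (Summable.tsum_union_disjoint (f := fun x : TraceMonoid R => t ^ len x) hdisj
    (summable_pow_len h avoiding_subset) (summable_pow_len h hBS)).symm

/-- Cartier-Foata inversion. -/
theorem mobius_mul_tsum (hs : ∀ a b, R a b → R b a)
    {𝕜 : Type*} [RCLike 𝕜] {t : 𝕜} {S : Set α}
    (h : Summable fun x : sub R S => ‖t‖ ^ len (x : TraceMonoid R)) (T : Finset α)
    (hT : (T : Set α) ⊆ S) :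
    Polynomial.aeval t (mobius R T) * ∑' x : sub R S, t ^ len (x : TraceMonoid R) =
      ∑' x : avoiding R S T, t ^ len (x : TraceMonoid R) := by
  classical
  -- Both sides obey the same deletion recursion, whose two terms involve proper subsets of `T`.
  induction T using Finset.strongInduction with
  | H T ih =>
    obtain rfl | ⟨b, hb⟩ := T.eq_empty_or_nonempty
    · have : avoiding R S ∅ = sub R S := by
        ext x
        simp [avoiding]
      rw [mobius_empty, map_one, one_mul, this]
      rfl
    · obtain ⟨T', hbT', rfl⟩ : ∃ T', b ∉ T' ∧ insert b T' = T :=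
        ⟨T.erase b, Finset.notMem_erase _ _, Finset.insert_erase hb⟩
      have hsub : T' ⊂ insert b T' := Finset.ssubset_insert hbT'
      have hsub' : (T'.filter fun c => ¬ R b c) ⊆ T' := Finset.filter_subset _ _
      rw [mobius_insert hs hbT', tsum_avoiding_insert hs h hbT' (hT (by simp)),
        ← ih T' hsub ((Finset.coe_subset.2 hsub.1).trans hT),
        ← ih _ (hsub'.trans_ssubset hsub)
          ((Finset.coe_subset.2 (hsub'.trans hsub.1)).trans hT)]
      simp only [map_sub, map_mul, Polynomial.aeval_X]
      ring

theorem avoiding_self {S : Finset α} : avoiding R (S : Set α) S = {1} := by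
  ext x
  simp only [Set.mem_singleton_iff]
  constructor
  · rintro ⟨h1, h2⟩
    by_contra hx
    obtain ⟨c, hc⟩ := exists_endsWith hx
    exact h2 c (mem_sub_iff.1 h1 c hc.count_pos) hc
  · rintro rfl
    exact ⟨Submonoid.one_mem _, fun c _ => not_endsWith_one c⟩

/-- Every trace except `1` has a last letter, so the right-hand side of the inversion collapses when
`T = S`. -/
theorem mobius_mul_tsum_self (hs : ∀ a b, R a b → R b a)
    {𝕜 : Type*} [RCLike 𝕜] {t : 𝕜} {S : Finset α}
    (h : Summable fun x : sub R (S : Set α) => ‖t‖ ^ len (x : TraceMonoid R)) :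
    Polynomial.aeval t (mobius R S) * ∑' x : sub R (S : Set α), t ^ len (x : TraceMonoid R) =
      1 := by
  rw [mobius_mul_tsum hs h S le_rfl, avoiding_self,
    tsum_singleton (1 : TraceMonoid R) (fun x => t ^ len x), len_one, pow_zero]

/-! ### The radius of convergence -/

/-- The number of traces of length `n` in `M_S`. -/
def numTraces (R : α → α → Prop) (S : Set α) (n : ℕ) : ℕ :=
  Nat.card ((fun x : sub R S => len (x : TraceMonoid R)) ⁻¹' {n})

/-- The choice of a word for every trace of given length. -/
def chosenWord (S : Set α) (n : ℕ)
    (x : (fun x : sub R S => len (x : TraceMonoid R)) ⁻¹' {n}) : List.Vector α n :=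
  ⟨(word_surjective (x.1 : TraceMonoid R)).choose, by
    have := (word_surjective (x.1 : TraceMonoid R)).choose_spec
    rw [← len_word (R := R), this]
    exact x.2⟩

theorem chosenWord_injective (S : Set α) (n : ℕ) :
    Function.Injective (chosenWord (R := R) S n) := by
  intro x y hxy
  have h := congrArg (fun w : List.Vector α n => word R w.1) hxy
  have hx := (word_surjective (x.1 : TraceMonoid R)).choose_spec
  have hy := (word_surjective (y.1 : TraceMonoid R)).choose_spec
  exact Subtype.ext (Subtype.ext (hx.symm.trans (h.trans hy)))

instance [Finite α] (S : Set α) (n : ℕ) :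
    Finite ((fun x : sub R S => len (x : TraceMonoid R)) ⁻¹' {n}) := by
  have := Fintype.ofFinite α
  exact Finite.of_injective _ (chosenWord_injective S n)

theorem numTraces_le [Fintype α] (S : Set α) (n : ℕ) : numTraces R S n ≤ Fintype.card α ^ n := by
  rw [numTraces, ← card_vector (α := α) n, ← Nat.card_eq_fintype_card]
  exact Nat.card_le_card_of_injective _ (chosenWord_injective S n)

theorem hasSum_numTraces {𝕜 : Type*} [RCLike 𝕜] {t : 𝕜} {S : Set α}
    (h : Summable fun x : sub R S => ‖t‖ ^ len (x : TraceMonoid R)) :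
    HasSum (fun n => (numTraces R S n : 𝕜) * t ^ n)
      (∑' x : sub R S, t ^ len (x : TraceMonoid R)) := by
  have h1 := (summable_pow_len h le_rfl).hasSum.tsum_fiberwise
    (fun x : sub R S => len (x : TraceMonoid R))
  refine h1.congr_fun fun n => ?_
  have h2 : ∀ x : (fun x : sub R S => len (x : TraceMonoid R)) ⁻¹' {n},
      t ^ len (x.1 : TraceMonoid R) = t ^ n := fun x => congrArg (t ^ ·) x.2
  rw [tsum_congr h2, tsum_const, nsmul_eq_mul]
  rfl

theorem summable_of_numTraces [Finite α] {t : ℝ} (ht : 0 ≤ t) {S : Set α}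
    (h : Summable fun n => (numTraces R S n : ℝ) * t ^ n) :
    Summable fun x : sub R S => t ^ len (x : TraceMonoid R) := by
  rw [← (Equiv.sigmaFiberEquiv fun x : sub R S => len (x : TraceMonoid R)).summable_iff]
  refine (summable_sigma_of_nonneg fun x => pow_nonneg ht _).2 ?_
  have hfin : ∀ n, Finite {x : sub R S // len (x : TraceMonoid R) = n} := fun n =>
    inferInstanceAs (Finite ((fun x : sub R S => len (x : TraceMonoid R)) ⁻¹' {n}))
  refine ⟨fun n => Summable.of_finite, h.congr fun n => ?_⟩
  have h2 : ∀ x : {x : sub R S // len (x : TraceMonoid R) = n},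
      t ^ len (x.1 : TraceMonoid R) = t ^ n := fun x => congrArg (t ^ ·) x.2
  refine Eq.trans ?_ (tsum_congr h2).symm
  rw [tsum_const, nsmul_eq_mul]
  rfl

theorem summable_of_small [Fintype α] {t : ℝ} (ht : 0 ≤ t) (h : Fintype.card α * t < 1)
    (S : Set α) : Summable fun x : sub R S => t ^ len (x : TraceMonoid R) := by
  refine summable_of_numTraces ht ?_
  refine Summable.of_nonneg_of_le (fun n => by positivity) (fun n => ?_)
    (summable_geometric_of_lt_one (by positivity) h)
  rw [mul_pow]
  gcongr
  exact_mod_cast numTraces_le S n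

/-- Inversion at `t = 0` excludes the zero polynomial; finiteness of the root set follows. -/
theorem mobius_ne_zero [Fintype α] (hs : ∀ a b, R a b → R b a)
    (S : Finset α) : mobius R S ≠ 0 := by
  intro h
  have := mobius_mul_tsum_self (t := (0 : ℝ)) (S := S) hs
    (by simpa using summable_of_small (R := R) (t := 0) le_rfl (by simp) (S : Set α))
  simp [h] at this

/-- The infimum over finitely many roots is attained, which preserves strictness; `c < ⊤` handles
the case without roots. -/
theorem lt_pRoot_iff [Fintype α] (hs : ∀ a b, R a b → R b a)
    {S : Finset α} {c : ℝ≥0∞} (hc : c < ⊤) :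
    c < pRoot R S ↔ ∀ z : ℂ, Polynomial.aeval z (mobius R S) = 0 → c < ‖z‖ₑ := by
  constructor
  · exact fun h z hz => h.trans_le (iInf₂_le z hz)
  · intro h
    have hfin : {z : ℂ | Polynomial.aeval z (mobius R S) = 0}.Finite := by
      refine (Polynomial.rootSet_finite (mobius R S) ℂ).subset fun z hz => ?_
      exact Polynomial.mem_rootSet.2 ⟨mobius_ne_zero hs S, hz⟩
    obtain hempty | hne := {z : ℂ | Polynomial.aeval z (mobius R S) = 0}.eq_empty_or_nonempty
    · refine hc.trans_le (le_iInf₂ fun z hz => ?_)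
      exact absurd (show z ∈ {z : ℂ | Polynomial.aeval z (mobius R S) = 0} from hz)
        (by rw [hempty]; exact Set.notMem_empty z)
    · obtain ⟨z₀, hz₀, hmin⟩ := Set.exists_min_image _ (fun z : ℂ => ‖z‖ₑ) hfin hne
      exact (h z₀ hz₀).trans_le (le_iInf₂ fun z hz => hmin z hz)

/-- `1/μ_S` is holomorphic on a closed disc of radius `r` with `t < r < p_S`, so its Taylor series
converges at `t`. Its coefficients are the numbers of traces, because inversion holds near `0`. -/
theorem summable_of_lt_pRoot [Fintype α] (hs : ∀ a b, R a b → R b a)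
    {S : Finset α} {t : ℝ} (ht : 0 ≤ t) (h : ENNReal.ofReal t < pRoot R S) :
    Summable fun x : sub R (S : Set α) => t ^ len (x : TraceMonoid R) := by
  obtain ⟨r, htr, hrp⟩ := ENNReal.lt_iff_exists_nnreal_btwn.1 h
  have htr' : t < r := (ENNReal.ofReal_lt_coe_iff ht).1 htr
  have hr0 : 0 < r := by exact_mod_cast ht.trans_lt htr'
  set f : ℂ → ℂ := fun z => (Polynomial.aeval z (mobius R S))⁻¹ with hf
  have hd : DifferentiableOn ℂ f (Metric.closedBall 0 r) := by
    intro z hz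
    have hz0 : Polynomial.aeval z (mobius R S) ≠ 0 := by
      intro hz0
      have h1 := (lt_pRoot_iff hs ENNReal.coe_lt_top).1 hrp z hz0
      rw [mem_closedBall_zero_iff] at hz
      rw [enorm_eq_nnnorm, ENNReal.coe_lt_coe] at h1
      exact absurd hz (not_le.2 h1)
    have h2 : DifferentiableAt ℂ (fun z : ℂ => Polynomial.aeval z (mobius R S)) z :=
      (Polynomial.differentiable_aeval _).differentiableAt
    exact (h2.inv hz0).differentiableWithinAt
  have hser := hd.hasFPowerSeriesOnBall hr0
  have hser' : HasFPowerSeriesAt f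
      (FormalMultilinearSeries.ofScalars ℂ fun n => (numTraces R (S : Set α) n : ℂ)) 0 := by
    rw [hasFPowerSeriesAt_iff]
    -- On this disc the crude bound of `card α ^ n` traces of length `n` already gives convergence.
    have hε : 0 < 1 / (Fintype.card α + 1 : ℝ) := by positivity
    filter_upwards [Metric.ball_mem_nhds (0 : ℂ) hε] with z hz
    rw [mem_ball_zero_iff, lt_div_iff₀ (by positivity)] at hz
    have hz1 : Summable fun x : sub R (S : Set α) => ‖z‖ ^ len (x : TraceMonoid R) :=
      summable_of_small (norm_nonneg z) (by nlinarith [norm_nonneg z]) _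
    have h1 := hasSum_numTraces hz1
    have h2 := mobius_mul_tsum_self hs hz1
    rw [eq_inv_of_mul_eq_one_right h2] at h1
    simpa [hf, FormalMultilinearSeries.coeff_ofScalars, mul_comm] using h1
  have hcoef := hser.hasFPowerSeriesAt.eq_formalMultilinearSeries hser'
  have hsum := hser.hasSum (y := (t : ℂ)) (by
    simpa [Metric.mem_eball, abs_of_nonneg ht] using htr')
  rw [hcoef] at hsum
  refine summable_of_numTraces ht ?_
  have h3 := hsum.summable
  simp only [FormalMultilinearSeries.ofScalars_apply_eq] at h3
  rw [← Complex.summable_ofReal]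
  simpa using h3


/-- For the converse, a root of modulus at most `t` would turn the inversion formula into `0 = 1`.
-/
theorem summable_iff_lt_pRoot [Fintype α] (hs : ∀ a b, R a b → R b a) {S : Finset α} {t : ℝ}
    (ht : 0 ≤ t) :
    (Summable fun x : sub R (S : Set α) => t ^ len (x : TraceMonoid R)) ↔
      ENNReal.ofReal t < pRoot R S := by
  refine ⟨fun h => (lt_pRoot_iff hs ENNReal.ofReal_lt_top).2 fun z hz => ?_,
    summable_of_lt_pRoot hs ht⟩
  by_contra hlt
  rw [not_lt, ← ofReal_norm, ENNReal.ofReal_le_ofReal_iff ht] at hlt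
  have hz1 : Summable fun x : sub R (S : Set α) => ‖z‖ ^ len (x : TraceMonoid R) :=
    Summable.of_nonneg_of_le (fun _ => by positivity) (fun _ => by gcongr) h
  have := mobius_mul_tsum_self hs hz1
  rw [hz, zero_mul] at this
  exact zero_ne_one this

theorem pRoot_pos [Fintype α] (hs : ∀ a b, R a b → R b a) (S : Finset α) : 0 < pRoot R S := by
  rw [← ENNReal.ofReal_zero, ← summable_iff_lt_pRoot hs le_rfl]
  exact summable_of_small le_rfl (by simp) _

/-- At `t = 1` the powers of a single letter already make the series diverge. -/
theorem pRoot_lt_top [Fintype α] (hs : ∀ a b, R a b → R b a) {S : Finset α}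
    (hS : S.Nonempty) : pRoot R S < ⊤ := by
  obtain ⟨a, ha⟩ := hS
  refine lt_of_le_of_lt (not_lt.1 fun h => ?_) (ENNReal.ofReal_lt_top (r := 1))
  have h1 := (summable_iff_lt_pRoot hs zero_le_one).2 h
  have hmem : ∀ n : ℕ, letter R a ^ n ∈ sub R (S : Set α) := fun n =>
    Submonoid.pow_mem _ (letter_mem_sub_iff.2 ha) n
  have hlen : ∀ n : ℕ, len (letter R a ^ n) = n := fun n => by
    induction n with
    | zero => rw [pow_zero, len_one]
    | succ n ih => rw [pow_succ, len_mul, ih, len_letter]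
  have h2 := h1.comp_injective (i := fun n : ℕ => (⟨_, hmem n⟩ : sub R (S : Set α)))
    fun m n hmn => by
      have h3 := congrArg (fun z : sub R (S : Set α) => len (z : TraceMonoid R)) hmn
      simpa only [hlen] using h3
  have h4 := h2.tendsto_atTop_zero
  simp only [Function.comp_def, one_pow] at h4
  exact one_ne_zero (tendsto_nhds_unique tendsto_const_nhds h4)

theorem eval_mobius_mul_tsum [Fintype α] (hs : ∀ a b, R a b → R b a) {S : Finset α} {t : ℝ}
    (ht : 0 ≤ t) (h : ENNReal.ofReal t < pRoot R S) :
    (mobius R S).eval t * ∑' x : sub R (S : Set α), t ^ len (x : TraceMonoid R) = 1 := by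
  have h1 := (summable_iff_lt_pRoot hs ht).2 h
  have := mobius_mul_tsum_self (t := t) hs (by simpa only [Real.norm_of_nonneg ht] using h1)
  rwa [Polynomial.coe_aeval_eq_eval] at this

theorem eval_mobius_pos [Fintype α] (hs : ∀ a b, R a b → R b a) {S : Finset α} {t : ℝ}
    (ht : 0 ≤ t) (h : ENNReal.ofReal t < pRoot R S) : 0 < (mobius R S).eval t := by
  have h1 := eval_mobius_mul_tsum hs ht h
  have h2 : 0 ≤ ∑' x : sub R (S : Set α), t ^ len (x : TraceMonoid R) :=
    tsum_nonneg fun _ => pow_nonneg ht _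
  by_contra hcon
  nlinarith

theorem tendsto_eval_mobius (S : Finset α) (p : ℝ) :
    Filter.Tendsto (fun t => (mobius R S).eval t) (nhdsWithin p (Set.Iio p))
      (nhds ((mobius R S).eval p)) :=
  ((mobius R S).continuous.tendsto p).mono_left nhdsWithin_le_nhds

theorem eventually_lt_pRoot [Fintype α] (hs : ∀ a b, R a b → R b a) {S : Finset α}
    (hS : pRoot R S < ⊤) :
    ∀ᶠ t in nhdsWithin (pRoot R S).toReal (Set.Iio (pRoot R S).toReal),
      0 ≤ t ∧ ENNReal.ofReal t < pRoot R S := by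
  have hp : 0 < (pRoot R S).toReal := ENNReal.toReal_pos (pRoot_pos hs S).ne' hS.ne
  filter_upwards [Ioo_mem_nhdsLT hp] with t ht
  exact ⟨ht.1.le, (ENNReal.ofReal_lt_iff_lt_toReal ht.1.le hS.ne).2 ht.2⟩

/-- A Pringsheim-type argument: the radius of convergence is itself a root. If `μ_S` were positive
there, the bound `1/μ_S(t)` on finite partial sums would pass to the limit and give convergence at
`p_S`. -/
theorem eval_mobius_pRoot [Fintype α] (hs : ∀ a b, R a b → R b a) {S : Finset α}
    (hS : pRoot R S < ⊤) : (mobius R S).eval (pRoot R S).toReal = 0 := by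
  set p := (pRoot R S).toReal with hp
  have hev := eventually_lt_pRoot hs hS
  have hlim := tendsto_eval_mobius (R := R) S p
  have hnonneg : 0 ≤ (mobius R S).eval p :=
    ge_of_tendsto hlim (hev.mono fun t ht => (eval_mobius_pos hs ht.1 ht.2).le)
  by_contra hne
  have hpos : 0 < (mobius R S).eval p := lt_of_le_of_ne hnonneg (Ne.symm hne)
  have hp0 : 0 ≤ p := ENNReal.toReal_nonneg
  have hsum : Summable fun x : sub R (S : Set α) => p ^ len (x : TraceMonoid R) := by
    refine summable_of_sum_le (c := ((mobius R S).eval p)⁻¹) (fun _ => pow_nonneg hp0 _)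
      fun u => ?_
    have hcont : Filter.Tendsto (fun t : ℝ => ∑ x ∈ u, t ^ len (x : TraceMonoid R))
        (nhdsWithin p (Set.Iio p)) (nhds (∑ x ∈ u, p ^ len (x : TraceMonoid R))) :=
      ((continuous_finsetSum u fun x _ => continuous_pow _).tendsto p).mono_left
        nhdsWithin_le_nhds
    refine le_of_tendsto_of_tendsto hcont (hlim.inv₀ hpos.ne') ?_
    filter_upwards [hev] with t ht
    rw [← eq_inv_of_mul_eq_one_right (eval_mobius_mul_tsum hs ht.1 ht.2)]
    exact ((summable_iff_lt_pRoot hs ht.1).2 ht.2).sum_le_tsum u fun _ _ => pow_nonneg ht.1 _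
  have := (summable_iff_lt_pRoot hs hp0).1 hsum
  rw [ENNReal.ofReal_toReal hS.ne] at this
  exact lt_irrefl _ this

/-! ### Pyramidal traces and their generating function -/

section Pyramids

variable [Fintype α] [DecidableEq α]

/-- The traces `z` such that `z * a` is pyramidal. -/
def basis (R : α → α → Prop) (a : α) : Set (TraceMonoid R) :=
  {z | count a z = 0 ∧ MaxIn (link R a) z}

theorem mem_sub_erase {a : α} {z : TraceMonoid R} :
    z ∈ sub R ((Finset.univ.erase a : Finset α) : Set α) ↔ count a z = 0 := by
  rw [mem_sub_iff]
  constructor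
  · intro h
    by_contra hne
    simpa using h a (Nat.pos_of_ne_zero hne)
  · rintro h b hb
    simp only [Finset.coe_erase, Finset.coe_univ, Set.mem_sdiff, Set.mem_univ, true_and,
      Set.mem_singleton_iff]
    rintro rfl
    omega

open Classical in
-- Ending only in letters linked to `a` means avoiding the letters that commute with `a`, so the
-- inversion formula applies to the basis.
theorem avoiding_eq_basis (a : α) :
    avoiding R ((Finset.univ.erase a : Finset α) : Set α)
      ((Finset.univ.erase a).filter fun c => ¬ R a c) = basis R a := by
  ext z
  simp only [avoiding, basis, Set.mem_ofPred_eq, mem_sub_erase, maxIn_iff]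
  refine and_congr_right fun h => ⟨fun h1 c hc => ?_, fun h1 c hc hcz => ?_⟩
  · by_contra hcon
    refine h1 c ?_ hc
    rw [Finset.mem_filter, Finset.mem_erase]
    refine ⟨⟨?_, Finset.mem_univ c⟩, hcon⟩
    rintro rfl
    have := hc.count_pos
    omega
  · exact (Finset.mem_filter.1 hc).2 (h1 c hcz)

/-- Inversion gives `μ_T / μ_{Σ∖a}` for the basis, with `T` the letters that commute with `a`;
deleting `a` in `μ_Σ` rewrites `t * μ_T` as a difference. -/
theorem mul_tsum_basis (hs : ∀ a b, R a b → R b a) (a : α) {t : ℝ}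
    (ht : 0 ≤ t) (h : ENNReal.ofReal t < pRoot R (Finset.univ.erase a)) :
    (mobius R (Finset.univ.erase a)).eval t * (t * ∑' z : basis R a, t ^ len (z : TraceMonoid R)) =
      (mobius R (Finset.univ.erase a)).eval t - (mobius R Finset.univ).eval t := by
  classical
  have h1 := (summable_iff_lt_pRoot hs ht).2 h
  have h2 := mobius_mul_tsum (t := t) hs (by simpa only [Real.norm_of_nonneg ht] using h1)
    ((Finset.univ.erase a).filter fun c => ¬ R a c)
    (Finset.coe_subset.2 (Finset.filter_subset _ _))
  rw [avoiding_eq_basis, Polynomial.coe_aeval_eq_eval] at h2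
  have h3 := mobius_insert hs (Finset.notMem_erase a Finset.univ)
  have h4 : mobius R Finset.univ = mobius R (Finset.univ.erase a) -
      Polynomial.X * mobius R ((Finset.univ.erase a).filter fun c => ¬ R a c) := by
    rw [← h3]
    congr 1
    ext b
    by_cases hb : b = a <;> simp [hb]
  have h5 := eval_mobius_mul_tsum hs ht h
  rw [h4, Polynomial.eval_sub, Polynomial.eval_mul, Polynomial.eval_X, ← h2]
  linear_combination t * Polynomial.eval t
    (mobius R ((Finset.univ.erase a).filter fun c => ¬ R a c)) * h5

theorem basis_subset (a : α) :
    basis R a ⊆ sub R ((Finset.univ.erase a : Finset α) : Set α) :=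
  fun _ h => mem_sub_erase.2 h.1

theorem summable_basis (hs : ∀ a b, R a b → R b a) (a : α) {t : ℝ}
    (ht : 0 ≤ t) (h : ENNReal.ofReal t < pRoot R (Finset.univ.erase a)) :
    Summable fun z : basis R a => t ^ len (z : TraceMonoid R) :=
  summable_pow_len (by simpa only [Real.norm_of_nonneg ht] using (summable_iff_lt_pRoot hs ht).2 h)
    (basis_subset a)

/-- Suppose `q = p_{Σ∖a} ≤ p_Σ`. For `t < q` the pyramid series `1 - μ_Σ/μ_{Σ∖a}` is at least
`t^(|w|+1) / μ_{Σ∖a}`, where `w * a` is a full pyramid. As `μ_Σ(t) > 0`, this gives `t^(|w|+1) ≤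
μ_{Σ∖a}(t)`, and `t → q` contradicts `μ_{Σ∖a}(q) = 0`. -/
theorem pRoot_univ_lt (hr : ∀ a, R a a) (hs : ∀ a b, R a b → R b a)
    (hirr : (SimpleGraph.fromRel R).Connected) (a : α) :
    pRoot R Finset.univ < pRoot R (Finset.univ.erase a) := by
  by_contra hcon
  rw [not_lt] at hcon
  have htop : pRoot R (Finset.univ.erase a) < ⊤ :=
    hcon.trans_lt (pRoot_lt_top hs ⟨a, Finset.mem_univ a⟩)
  obtain ⟨v, hv, hfull⟩ := exists_isPyramid_full hs hirr a
  obtain ⟨w, rfl⟩ := hv.endsWith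
  set q := (pRoot R (Finset.univ.erase a)).toReal with hq
  have hq0 : 0 < q := ENNReal.toReal_pos (pRoot_pos hs _).ne' htop.ne
  have hcont : Filter.Tendsto (fun t : ℝ => t ^ (len w + 1)) (nhdsWithin q (Set.Iio q))
      (nhds (q ^ (len w + 1))) :=
    ((continuous_pow _).tendsto q).mono_left nhdsWithin_le_nhds
  have hle : q ^ (len w + 1) ≤ (mobius R (Finset.univ.erase a)).eval q := by
    refine le_of_tendsto_of_tendsto hcont (tendsto_eval_mobius _ q) ?_
    filter_upwards [eventually_lt_pRoot hs htop] with t ht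
    have h1 := eval_mobius_pos hs ht.1 ht.2
    have h2 := eval_mobius_pos hs ht.1 (ht.2.trans_le hcon)
    have h3 := mul_tsum_basis hs a ht.1 ht.2
    have h4 := eval_mobius_mul_tsum hs ht.1 ht.2
    have hmem : ∀ z : sub R ((Finset.univ.erase a : Finset α) : Set α),
        (z : TraceMonoid R) * w ∈ basis R a := fun z =>
      (isPyramid_mul_letter hr hs).1 (by
        rw [mul_assoc]
        exact hv.mul_of_full hr hs hfull (mem_sub_erase.1 z.2))
    -- The injection `z ↦ z * w` embeds all of `M_{Σ∖a}` into the basis.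
    have h5 : t ^ len w * ∑' x : sub R ((Finset.univ.erase a : Finset α) : Set α),
        t ^ len (x : TraceMonoid R) ≤ ∑' z : basis R a, t ^ len (z : TraceMonoid R) := by
      rw [← tsum_mul_left]
      refine Summable.tsum_le_tsum_of_inj (fun z => (⟨_, hmem z⟩ : basis R a)) ?_
        (fun _ _ => pow_nonneg ht.1 _) (fun z => ?_)
        (((summable_iff_lt_pRoot hs ht.1).2 ht.2).mul_left _) (summable_basis hs a ht.1 ht.2)
      · intro x y hxy
        exact Subtype.ext (cancel_right hs (congrArg (fun z : basis R a => (z : TraceMonoid R)) hxy))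
      · simp only [len_mul]
        rw [pow_add, mul_comm]
    have h6 := mul_le_mul_of_nonneg_left (mul_le_mul_of_nonneg_left h5 ht.1) h1.le
    rw [h3] at h6
    have h7 : t ^ (len w + 1) ≤ (mobius R (Finset.univ.erase a)).eval t -
        (mobius R Finset.univ).eval t := by
      refine le_trans (le_of_eq ?_) h6
      rw [pow_succ]
      linear_combination (-(t ^ len w * t)) * h4
    linarith
  rw [eval_mobius_pRoot hs htop] at hle
  exact absurd hle (not_le.2 (pow_pos hq0 _))

theorem mul_tsum_basis_pRoot (hr : ∀ a, R a a) (hs : ∀ a b, R a b → R b a)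
    (hirr : (SimpleGraph.fromRel R).Connected) (a : α) :
    (pRoot R Finset.univ).toReal *
      ∑' z : basis R a, (pRoot R Finset.univ).toReal ^ len (z : TraceMonoid R) = 1 := by
  have htop : pRoot R Finset.univ < ⊤ := pRoot_lt_top hs ⟨a, Finset.mem_univ a⟩
  have hlt := pRoot_univ_lt hr hs hirr a
  rw [← ENNReal.ofReal_toReal htop.ne] at hlt
  have h1 := mul_tsum_basis hs a ENNReal.toReal_nonneg hlt
  rw [eval_mobius_pRoot hs htop, sub_zero] at h1
  have h2 := eval_mobius_pos hs ENNReal.toReal_nonneg hlt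
  exact mul_left_cancel₀ h2.ne' (h1.trans (mul_one _).symm)

/-- The probability distribution of the pyramidal traces sums to `1`. -/
theorem tsum_pyr (hr : ∀ a, R a a) (hs : ∀ a b, R a b → R b a)
    (hirr : (SimpleGraph.fromRel R).Connected) (a : α) :
    ∑' v : Pyr R a, pRoot R Finset.univ ^ len (v : TraceMonoid R) = 1 := by
  have htop : pRoot R Finset.univ < ⊤ := pRoot_lt_top hs ⟨a, Finset.mem_univ a⟩
  have hlt := pRoot_univ_lt hr hs hirr a
  rw [← ENNReal.ofReal_toReal htop.ne] at hlt
  have himage : Pyr R a = (fun z => z * letter R a) '' basis R a := by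
    ext v
    rw [mem_pyr_iff hr hs]
    constructor
    · intro hv
      obtain ⟨z, rfl⟩ := hv.endsWith
      exact ⟨z, (isPyramid_mul_letter hr hs).1 hv, rfl⟩
    · rintro ⟨z, hz, rfl⟩
      exact (isPyramid_mul_letter hr hs).2 hz
  rw [himage, tsum_image (f := fun x : TraceMonoid R => pRoot R Finset.univ ^ len x)
    (fun x _ y _ hxy => cancel_right hs hxy)]
  rw [← ENNReal.ofReal_toReal htop.ne]
  simp only [len_mul, len_letter]
  have h1 := mul_tsum_basis_pRoot hr hs hirr a
  rw [← tsum_mul_left] at h1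
  rw [← ENNReal.ofReal_one, ← h1, ENNReal.ofReal_tsum_of_nonneg
    (fun _ => mul_nonneg ENNReal.toReal_nonneg (pow_nonneg ENNReal.toReal_nonneg _))
    ((summable_basis hs a ENNReal.toReal_nonneg hlt).mul_left _)]
  refine tsum_congr fun z => ?_
  rw [← pow_succ', ENNReal.ofReal_pow ENNReal.toReal_nonneg]

end Pyramids


/-! ### Cylinders -/

instance : DiscreteMeasurableSpace (TraceMonoid R) := ⟨fun _ => trivial⟩

instance [Finite α] : Countable (TraceMonoid R) := word_surjective.countable

theorem NDSeq.dvd_of_le (s : NDSeq R) {m n : ℕ} (h : m ≤ n) : s.seq m ∣ s.seq n := by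
  induction n, h using Nat.le_induction with
  | base => exact dvd_rfl
  | succ n _ ih => exact ih.trans (s.mono n)

theorem exists_lim_eq (ξ : Boundary R) : ∃ s : NDSeq R, GenTrace.lim s = ξ.1 := by
  obtain ⟨⟨s⟩, h⟩ := ξ
  exact ⟨s, rfl⟩

theorem ofTrace_le_lim {x : TraceMonoid R} {s : NDSeq R} :
    GenTrace.ofTrace x ≤ GenTrace.lim s ↔ ∃ k, x ∣ s.seq k := by
  rw [GenTrace.ofTrace, GenTrace.lim, GenTrace.lim,
    toAntisymmetrization_le_toAntisymmetrization_iff]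
  exact ⟨fun h => h 0, fun h _ => h⟩

theorem mem_cylinder_iff {x : TraceMonoid R} {ξ : Boundary R} {s : NDSeq R}
    (hs : GenTrace.lim s = ξ.1) : ξ ∈ cylinder x ↔ ∃ k, x ∣ s.seq k := by
  rw [← ofTrace_le_lim, hs]
  rfl

theorem exists_dvd_dvd {x y : TraceMonoid R} {s : NDSeq R} (hx : ∃ k, x ∣ s.seq k)
    (hy : ∃ k, y ∣ s.seq k) : ∃ k, x ∣ s.seq k ∧ y ∣ s.seq k := by
  obtain ⟨k, hk⟩ := hx
  obtain ⟨l, hl⟩ := hy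
  exact ⟨max k l, hk.trans (s.dvd_of_le (le_max_left _ _)),
    hl.trans (s.dvd_of_le (le_max_right _ _))⟩

theorem cylinder_one : cylinder (1 : TraceMonoid R) = Set.univ := by
  ext ξ
  obtain ⟨s, h⟩ := exists_lim_eq ξ
  simp [mem_cylinder_iff h]

theorem measurableSet_cylinder (x : TraceMonoid R) : MeasurableSet (cylinder x) :=
  MeasurableSpace.measurableSet_generateFrom ⟨x, rfl⟩

/-- When two cylinders meet, the residual `r` makes `x * r` the least common multiple of the bases.
-/
theorem isPiSystem_cylinder (hs : ∀ a b, R a b → R b a) :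
    IsPiSystem (Set.range (cylinder (R := R))) := by
  rintro _ ⟨x, rfl⟩ _ ⟨y, rfl⟩ ⟨ξ, hξx, hξy⟩
  obtain ⟨r, hr⟩ | hno := exists_residual hs x y
  · refine ⟨x * r, ?_⟩
    ext η
    obtain ⟨s, h⟩ := exists_lim_eq η
    rw [Set.mem_inter_iff, mem_cylinder_iff h, mem_cylinder_iff h, mem_cylinder_iff h]
    constructor
    · rintro ⟨k, hk⟩
      have hx : x ∣ s.seq k := (Dvd.intro r rfl).trans hk
      obtain ⟨m, hm⟩ := hx
      refine ⟨⟨k, m, hm⟩, k, ?_⟩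
      obtain ⟨n, hn⟩ := hk
      rw [hm, hr]
      exact ⟨n, cancel_left hs (by rw [← hm, hn, mul_assoc])⟩
    · rintro ⟨hx, hy⟩
      obtain ⟨k, ⟨m, hm⟩, hy⟩ := exists_dvd_dvd hx hy
      rw [hm, hr] at hy
      exact ⟨k, by rw [hm]; exact mul_dvd_mul_left x hy⟩
  · obtain ⟨s, h⟩ := exists_lim_eq ξ
    rw [mem_cylinder_iff h] at hξx hξy
    obtain ⟨k, ⟨m, hm⟩, hy⟩ := exists_dvd_dvd hξx hξy
    exact absurd (hm ▸ hy) (hno m)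

theorem IsUniformMeasure.unique [Fintype α] (hs : ∀ a b, R a b → R b a)
    {m m' : Measure (Boundary R)} (hm : IsUniformMeasure m) (hm' : IsUniformMeasure m') :
    m = m' := by
  have := hm.prob
  have := hm'.prob
  refine ext_of_generate_finite _ rfl (isPiSystem_cylinder hs) ?_ (by simp)
  rintro _ ⟨x, rfl⟩
  rw [hm.apply_cylinder, hm'.apply_cylinder]

theorem disjoint_cylinder_mul (hr : ∀ a, R a a) (hs : ∀ a b, R a b → R b a) {a : α}
    {v v' : TraceMonoid R} (hv : IsPyramid a v) (hv' : IsPyramid a v') (hne : v ≠ v')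
    (z : TraceMonoid R) : Disjoint (cylinder (z * v)) (cylinder (z * v')) := by
  rw [Set.disjoint_left]
  intro ξ h1 h2
  obtain ⟨s, h⟩ := exists_lim_eq ξ
  rw [mem_cylinder_iff h] at h1 h2
  obtain ⟨k, ⟨m, hm⟩, ⟨n, hn⟩⟩ := exists_dvd_dvd h1 h2
  refine hne (hv.unique hr hs hv' (Dvd.intro m rfl) ⟨n, ?_⟩)
  exact cancel_left hs (z := z) (by rw [← mul_assoc, ← mul_assoc, ← hm, hn])

/-! ### Infinite products of pyramidal traces -/

/-- The products of the first terms of a sequence of traces. -/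
def partialProd (ω : ℕ → TraceMonoid R) : ℕ → TraceMonoid R
  | 0 => 1
  | n + 1 => partialProd ω n * ω n

theorem partialProd_succ' (ω : ℕ → TraceMonoid R) (n : ℕ) :
    partialProd ω (n + 1) = ω 0 * partialProd (fun k => ω (k + 1)) n := by
  induction n with
  | zero => simp [partialProd]
  | succ n ih => rw [partialProd, ih, partialProd, mul_assoc]

/-- The non-decreasing sequence of the partial products. -/
def prodSeq (ω : ℕ → TraceMonoid R) : NDSeq R := ⟨partialProd ω, fun n => ⟨ω n, rfl⟩⟩

theorem count_partialProd {a : α} {ω : ℕ → TraceMonoid R} (h : ∀ n, IsPyramid a (ω n)) (n : ℕ) :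
    count a (partialProd ω n) = n := by
  induction n with
  | zero => exact count_one a
  | succ n ih => rw [partialProd, count_mul, ih, (h n).count_eq]

/-- A finite trace has a bounded number of occurrences of `a`, whereas each pyramidal factor adds
one. -/
theorem lim_prodSeq_notMem {a : α} {ω : ℕ → TraceMonoid R} (h : ∀ n, IsPyramid a (ω n)) :
    GenTrace.lim (prodSeq ω) ∉ Set.range (GenTrace.ofTrace (R := R)) := by
  rintro ⟨x, hx⟩
  have hle : GenTrace.lim (prodSeq ω) ≤ GenTrace.ofTrace x := hx.ge
  rw [GenTrace.ofTrace, GenTrace.lim, GenTrace.lim,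
    toAntisymmetrization_le_toAntisymmetrization_iff] at hle
  obtain ⟨_, n, hn⟩ := hle (count a x + 1)
  have h1 : x = partialProd ω (count a x + 1) * n := hn
  have h2 := congrArg (count a) h1
  rw [count_mul, count_partialProd h] at h2
  omega

/-! ### Existence of the uniform measure, by independent pyramids -/

section Construction

variable (hr : ∀ a, R a a) (hs : ∀ a b, R a b → R b a) (a : α)

/-- The infinite product of a sequence of pyramidal traces. -/
def infProd (ω : ℕ → Pyr R a) : Boundary R :=
  ⟨GenTrace.lim (prodSeq fun n => (ω n : TraceMonoid R)),
    lim_prodSeq_notMem fun n => (mem_pyr_iff hr hs).1 (ω n).2⟩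

theorem infProd_mem_cylinder {ω : ℕ → Pyr R a} {x : TraceMonoid R} :
    infProd hr hs a ω ∈ cylinder x ↔ ∃ n, x ∣ partialProd (fun n => (ω n : TraceMonoid R)) n :=
  mem_cylinder_iff (s := prodSeq fun n => (ω n : TraceMonoid R)) rfl

variable [Fintype α]

theorem measurable_partialProd (n : ℕ) :
    Measurable fun ω : ℕ → Pyr R a => partialProd (fun n => (ω n : TraceMonoid R)) n := by
  induction n with
  | zero => exact measurable_const
  | succ n ih =>
    have hmul : Measurable fun q : TraceMonoid R × TraceMonoid R => q.1 * q.2 :=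
      Measurable.of_discrete
    exact hmul.comp (ih.prodMk (measurable_subtype_coe.comp (measurable_pi_apply n)))

theorem measurable_infProd : Measurable (infProd hr hs a) := by
  refine measurable_generateFrom ?_
  rintro _ ⟨x, rfl⟩
  have : infProd hr hs a ⁻¹' cylinder x =
      ⋃ n, (fun ω : ℕ → Pyr R a => partialProd (fun n => (ω n : TraceMonoid R)) n) ⁻¹'
        {y | x ∣ y} := by
    ext ω
    simp [infProd_mem_cylinder]
  rw [this]
  exact MeasurableSet.iUnion fun n => measurable_partialProd a n (MeasurableSet.of_discrete)

/-- The sequence with given first term and given tail. -/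
def seqCons {X : Type*} (q : X × (ℕ → X)) : ℕ → X
  | 0 => q.1
  | n + 1 => q.2 n

theorem measurable_seqCons {X : Type*} [MeasurableSpace X] :
    Measurable (seqCons : X × (ℕ → X) → ℕ → X) := by
  refine measurable_pi_iff.2 fun n => ?_
  cases n with
  | zero => exact measurable_fst
  | succ n => exact (measurable_pi_apply n).comp measurable_snd

/-- Prepending an independent copy preserves the product law; this lets the first pyramid be split
off. -/
theorem map_seqCons {X : Type*} [MeasurableSpace X] (ν : Measure X) [IsProbabilityMeasure ν] :
    (ν.prod (Measure.infinitePi fun _ : ℕ => ν)).map seqCons =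
      Measure.infinitePi fun _ : ℕ => ν := by
  classical
  refine Measure.eq_infinitePi _ fun s t ht => ?_
  obtain ⟨N, hN⟩ : ∃ N, s ⊆ Finset.range (N + 1) :=
    ⟨s.sup id, fun i hi => Finset.mem_range_succ_iff.2 (Finset.le_sup (f := id) hi)⟩
  -- Padding with the whole space replaces `s` by an initial segment, on which the shift acts
  -- transparently.
  set t' : ℕ → Set X := fun i => if i ∈ s then t i else Set.univ with ht'
  have ht'm : ∀ i, MeasurableSet (t' i) := fun i => by
    simp only [ht']
    split_ifs
    · exact ht i
    · exact MeasurableSet.univ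
  have hpi : Set.pi (s : Set ℕ) t = Set.pi (Finset.range (N + 1) : Set ℕ) t' := by
    ext ω
    simp only [Set.mem_pi, ht']
    constructor
    · intro h i _
      split_ifs with his
      · exact h i his
      · exact Set.mem_univ _
    · intro h i hi
      have := h i (hN hi)
      rwa [if_pos (by exact hi)] at this
  have hprod : ∏ i ∈ s, ν (t i) = ∏ i ∈ Finset.range (N + 1), ν (t' i) := by
    rw [← Finset.prod_subset hN]
    · exact Finset.prod_congr rfl fun i hi => by simp only [ht', if_pos hi]
    · intro i _ hi
      simp only [ht', if_neg hi, measure_univ]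
  have hpre : seqCons ⁻¹' Set.pi (Finset.range (N + 1) : Set ℕ) t' =
      t' 0 ×ˢ Set.pi (Finset.range N : Set ℕ) (fun i => t' (i + 1)) := by
    ext ⟨x, ω⟩
    simp only [Set.mem_preimage, Set.mem_pi, Set.mem_prod, Finset.coe_range, Set.mem_Iio]
    constructor
    · exact fun h => ⟨h 0 (by omega), fun i hi => h (i + 1) (by omega)⟩
    · rintro ⟨h0, h1⟩ i hi
      cases i with
      | zero => exact h0
      | succ i => exact h1 i (by omega)
  rw [hpi, hprod, Measure.map_apply measurable_seqCons
    (MeasurableSet.pi (Set.to_countable _) fun i _ => ht'm i), hpre, Measure.prod_prod,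
    Measure.infinitePi_pi _ (fun i _ => ht'm (i + 1)), Finset.prod_range_succ', mul_comm]

variable (hirr : (SimpleGraph.fromRel R).Connected)

/-- The distribution of the random pyramidal traces. -/
def pyrPMF [DecidableEq α] : PMF (Pyr R a) :=
  ⟨fun v => pRoot R Finset.univ ^ len (v : TraceMonoid R), by
    rw [← tsum_pyr hr hs hirr a]
    exact ENNReal.summable.hasSum⟩

/-- The law of the infinite product of independent random pyramidal traces. -/
def prodLaw [DecidableEq α] : Measure (Boundary R) :=
  (Measure.infinitePi fun _ : ℕ => (pyrPMF hr hs a hirr).toMeasure).map (infProd hr hs a)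

variable [DecidableEq α]

instance : IsProbabilityMeasure (prodLaw hr hs a hirr) :=
  Measure.isProbabilityMeasure_map (measurable_infProd hr hs a).aemeasurable

/-- The first factor of the product is its only pyramidal divisor, so `u * x` divides the product
exactly when this factor is `u` and `x` divides the rest. -/
theorem prodLaw_cylinder_pyr_mul {u : TraceMonoid R} (hu : IsPyramid a u) (x : TraceMonoid R) :
    prodLaw hr hs a hirr (cylinder (u * x)) =
      pRoot R Finset.univ ^ len u * prodLaw hr hs a hirr (cylinder x) := by
  have hu' : u ∈ Pyr R a := (mem_pyr_iff hr hs).2 hu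
  have hm := measurable_infProd hr hs a
  have hpre : seqCons ⁻¹' (infProd hr hs a ⁻¹' cylinder (u * x)) =
      {(⟨u, hu'⟩ : Pyr R a)} ×ˢ (infProd hr hs a ⁻¹' cylinder x) := by
    ext ⟨v, ω⟩
    simp only [Set.mem_preimage, Set.mem_prod, Set.mem_singleton_iff, infProd_mem_cylinder]
    have hcons : ∀ n, partialProd (fun n => ((seqCons (v, ω) n : Pyr R a) : TraceMonoid R)) (n + 1) =
        v * partialProd (fun n => (ω n : TraceMonoid R)) n := fun n => partialProd_succ' _ n
    constructor
    · rintro ⟨n, hn⟩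
      have hn' : u * x ∣ v * partialProd (fun n => (ω n : TraceMonoid R)) n := by
        rw [← hcons]
        exact hn.trans ((prodSeq fun n => ((seqCons (v, ω) n : Pyr R a) : TraceMonoid R)).mono n)
      have huv : (v : TraceMonoid R) = u :=
        ((mem_pyr_iff hr hs).1 v.2).unique hr hs hu (Dvd.intro _ rfl)
          ((Dvd.intro x rfl).trans hn')
      refine ⟨Subtype.ext huv, n, ?_⟩
      obtain ⟨y, hy⟩ := hn'
      rw [huv, mul_assoc] at hy
      exact ⟨y, cancel_left hs hy⟩
    · rintro ⟨rfl, n, hn⟩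
      exact ⟨n + 1, by rw [hcons]; exact mul_dvd_mul_left u hn⟩
  rw [prodLaw, Measure.map_apply hm (measurableSet_cylinder _),
    Measure.map_apply hm (measurableSet_cylinder _)]
  conv_lhs => rw [← map_seqCons]
  rw [Measure.map_apply measurable_seqCons (hm (measurableSet_cylinder _)), hpre,
    Measure.prod_prod, PMF.toMeasure_apply_singleton _ _ (MeasurableSet.singleton _)]
  rfl

theorem prodLaw_cylinder_eq_tsum (z : TraceMonoid R) :
    prodLaw hr hs a hirr (cylinder z) =
      ∑' v : Pyr R a, prodLaw hr hs a hirr (cylinder (z * v)) := by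
  have hm := measurable_infProd hr hs a
  have hpre : infProd hr hs a ⁻¹' cylinder z =
      ⋃ v : Pyr R a, infProd hr hs a ⁻¹' cylinder (z * (v : TraceMonoid R)) := by
    ext ω
    simp only [Set.mem_iUnion, Set.mem_preimage, infProd_mem_cylinder]
    constructor
    · rintro ⟨n, hn⟩
      -- With this many factors the product has more occurrences of `a` than `z`, so the quotient
      -- `y` contains an `a`.
      obtain ⟨y, hy⟩ : z ∣ partialProd (fun n => (ω n : TraceMonoid R)) (n + count a z + 1) :=
        hn.trans ((prodSeq fun n => (ω n : TraceMonoid R)).dvd_of_le (n := n + count a z + 1)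
          (by omega))
      have hc := congrArg (count a) hy
      rw [count_partialProd (fun n => (mem_pyr_iff hr hs).1 (ω n).2), count_mul] at hc
      obtain ⟨v, hv, x, rfl⟩ := exists_isPyramid_dvd hs (show 0 < count a y by omega)
      exact ⟨⟨v, (mem_pyr_iff hr hs).2 hv⟩, _, x, by rw [hy, mul_assoc]⟩
    · rintro ⟨v, n, hn⟩
      exact ⟨n, (Dvd.intro _ rfl).trans hn⟩
  simp only [prodLaw, Measure.map_apply hm (measurableSet_cylinder _)]
  rw [hpre, measure_iUnion]
  · intro v v' hne
    exact (disjoint_cylinder_mul hr hs ((mem_pyr_iff hr hs).1 v.2) ((mem_pyr_iff hr hs).1 v'.2)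
      (fun h => hne (Subtype.ext h)) z).preimage _
  · exact fun v => hm (measurableSet_cylinder _)

/-- With `F` the mass of cylinders, `F z = ∑ F (z * v)` over the pyramids `v`. By induction on
`|z|`, each term is `p^|v|` times either `F z` or `p^|z|`. The weights sum to 1 and the second value
does occur, so `F z = p^|z|`. -/
theorem prodLaw_cylinder_of_count_eq_zero (z : TraceMonoid R) (hz : count a z = 0) :
    prodLaw hr hs a hirr (cylinder z) = pRoot R Finset.univ ^ len z := by
  have hp0 : pRoot R Finset.univ ≠ 0 := (pRoot_pos hs _).ne'
  have hptop : pRoot R Finset.univ ≠ ⊤ := (pRoot_lt_top hs ⟨a, Finset.mem_univ a⟩).ne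
  induction hn : len z using Nat.strong_induction_on generalizing z with
  | _ n ih =>
  subst hn
  by_cases hz1 : z = 1
  · rw [hz1, cylinder_one, measure_univ, len_one, pow_zero]
  set p := pRoot R Finset.univ with hp
  set F := fun x => prodLaw hr hs a hirr (cylinder x) with hF
  have hF1 : ∀ v : TraceMonoid R, IsPyramid a v → F v = p ^ len v := fun v hv => by
    have := prodLaw_cylinder_pyr_mul hr hs a hirr hv 1
    rwa [mul_one, cylinder_one, measure_univ, mul_one] at this
  have hcases : ∀ v : Pyr R a, F (z * v) = p ^ len (v : TraceMonoid R) * F z ∨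
      F (z * v) = p ^ len (v : TraceMonoid R) * p ^ len z := by
    intro v
    -- If nothing of `z` lies below the summit, then `z` commutes with `v` and `F z` reappears;
    -- otherwise the part `z'` that moves past `v` is shorter than `z`.
    obtain ⟨y, z', hyz, h1, h2⟩ := ((mem_pyr_iff hr hs).1 v.2).exists_split hs hz
    have h3 : z * v = y * v * z' := by rw [hyz, mul_assoc, h2, mul_assoc]
    have h4 : F (z * v) = p ^ len (y * (v : TraceMonoid R)) * F z' := by
      rw [h3]
      exact prodLaw_cylinder_pyr_mul hr hs a hirr h1 z'
    by_cases hy : y = 1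
    · left
      rw [h4, hyz, hy, one_mul, one_mul]
    · right
      have hlen : 0 < len y := Nat.pos_of_ne_zero fun h => hy (eq_one_of_len_eq_zero h)
      have hc : count a z' = 0 := by
        rw [hyz, count_mul] at hz
        omega
      have h5 : F z' = p ^ len z' := ih (len z') (by rw [hyz, len_mul]; omega) z' hc rfl
      rw [h4, h5, hyz, len_mul, len_mul, ← pow_add, ← pow_add]
      congr 1
      omega
  obtain ⟨v₀, hv₀, hfull⟩ := exists_isPyramid_full hs hirr a
  -- A full pyramid absorbs all of `z`, so this term takes the value with `p^|z|`; it makes the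
  -- comparison of sums strict.
  have hF0 : F (z * v₀) = p ^ len v₀ * p ^ len z := by
    rw [hF1 _ (hv₀.mul_of_full hr hs hfull hz), len_mul, ← pow_add, add_comm]
  let w₀ : Pyr R a := ⟨v₀, (mem_pyr_iff hr hs).2 hv₀⟩
  have hsum : F z = ∑' v : Pyr R a, F (z * v) := prodLaw_cylinder_eq_tsum hr hs a hirr z
  have hsum' : ∑' v : Pyr R a, p ^ len (v : TraceMonoid R) * F z = F z := by
    rw [ENNReal.tsum_mul_right, tsum_pyr hr hs hirr a, one_mul]
  have hFtop : F z ≠ ⊤ := measure_ne_top _ _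
  have hpow0 : p ^ len v₀ ≠ 0 := pow_ne_zero _ hp0
  have hpowtop : p ^ len v₀ ≠ ⊤ := ENNReal.pow_ne_top hptop
  obtain hlt | heq | hgt := lt_trichotomy (F z) (p ^ len z)
  · have := ENNReal.tsum_lt_tsum (f := fun v : Pyr R a => p ^ len (v : TraceMonoid R) * F z)
      (g := fun v : Pyr R a => F (z * v)) (i := w₀) (by rwa [hsum']) (fun v => ?_) ?_
    · rw [hsum', ← hsum] at this
      exact absurd this (lt_irrefl _)
    · obtain h | h := hcases v
      · exact h.ge
      · simp only [h]
        gcongr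
    · change p ^ len v₀ * F z < F (z * v₀)
      rw [hF0]
      exact ENNReal.mul_lt_mul_right hpow0 hpowtop hlt
  · exact heq
  · have := ENNReal.tsum_lt_tsum (g := fun v : Pyr R a => p ^ len (v : TraceMonoid R) * F z)
      (f := fun v : Pyr R a => F (z * v)) (i := w₀) (by rwa [← hsum]) (fun v => ?_) ?_
    · rw [hsum', ← hsum] at this
      exact absurd this (lt_irrefl _)
    · obtain h | h := hcases v
      · exact h.le
      · simp only [h]
        gcongr
    · change F (z * v₀) < p ^ len v₀ * F z
      rw [hF0]
      exact ENNReal.mul_lt_mul_right hpow0 hpowtop hgt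

/-- Each pyramid split off on the left removes one `a`, until the case without `a` is reached. -/
theorem prodLaw_cylinder (x : TraceMonoid R) :
    prodLaw hr hs a hirr (cylinder x) = pRoot R Finset.univ ^ len x := by
  induction hn : count a x generalizing x with
  | zero => exact prodLaw_cylinder_of_count_eq_zero hr hs a hirr x hn
  | succ n ih =>
    obtain ⟨v, hv, y, rfl⟩ := exists_isPyramid_dvd hs (show 0 < count a x by omega)
    rw [count_mul, hv.count_eq] at hn
    rw [prodLaw_cylinder_pyr_mul hr hs a hirr hv, ih y (by omega), len_mul, pow_add]

theorem isUniformMeasure_prodLaw : IsUniformMeasure (prodLaw hr hs a hirr) :=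
  ⟨inferInstance, prodLaw_cylinder hr hs a hirr⟩

end Construction


/-! ### The first pyramid of an infinite trace -/

theorem isVInf_iff (hr : ∀ a, R a a) (hs : ∀ a b, R a b → R b a) {a : α} {ξ : Boundary R}
    {v : TraceMonoid R} : IsVInf a ξ v ↔ IsPyramid a v ∧ ξ ∈ cylinder v := by
  constructor
  · rintro ⟨s, h, q, hq⟩
    obtain ⟨h1, h2⟩ := (isV_iff hr hs).1 (hq q le_rfl)
    exact ⟨h1, (mem_cylinder_iff h).2 ⟨q, h2⟩⟩
  · rintro ⟨h1, h2⟩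
    obtain ⟨s, h⟩ := exists_lim_eq ξ
    obtain ⟨k, hk⟩ := (mem_cylinder_iff h).1 h2
    exact ⟨s, h, k, fun n hn => (isV_iff hr hs).2 ⟨h1, hk.trans (s.dvd_of_le hn)⟩⟩

theorem isVInf_unique (hr : ∀ a, R a a) (hs : ∀ a b, R a b → R b a) {a : α} {ξ : Boundary R}
    {v v' : TraceMonoid R} (h : IsVInf a ξ v) (h' : IsVInf a ξ v') : v = v' := by
  rw [isVInf_iff hr hs] at h h'
  by_contra hne
  have hd := disjoint_cylinder_mul hr hs h.1 h'.1 hne 1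
  rw [one_mul, one_mul, Set.disjoint_left] at hd
  exact hd h.2 h'.2

/-- The default value `1` is not a pyramid, so points where the map is undefined do not interfere.
-/
theorem vInf_eq_iff (hr : ∀ a, R a a) (hs : ∀ a b, R a b → R b a) {a : α} {ξ : Boundary R}
    {v : TraceMonoid R} (hv : IsPyramid a v) : VInf a ξ = v ↔ ξ ∈ cylinder v := by
  unfold VInf
  split_ifs with h
  · constructor
    · intro hv'
      have := h.choose_spec
      rw [hv'] at this
      exact ((isVInf_iff hr hs).1 this).2
    · intro hξ
      exact isVInf_unique hr hs h.choose_spec ((isVInf_iff hr hs).2 ⟨hv, hξ⟩)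
  · refine ⟨fun h1 => absurd h1.symm hv.ne_one, fun hξ => absurd ⟨v, ?_⟩ h⟩
    exact (isVInf_iff hr hs).2 ⟨hv, hξ⟩

theorem vInf_eq_one_or (hr : ∀ a, R a a) (hs : ∀ a b, R a b → R b a) (a : α) (ξ : Boundary R) :
    VInf a ξ = 1 ∨ IsPyramid a (VInf a ξ) := by
  unfold VInf
  split_ifs with h
  · exact Or.inr ((isVInf_iff hr hs).1 h.choose_spec).1
  · exact Or.inl rfl

theorem measurable_vInf [Finite α] (hr : ∀ a, R a a) (hs : ∀ a b, R a b → R b a) (a : α) :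
    Measurable (VInf (R := R) a) := by
  have hpyr : ∀ v : TraceMonoid R, IsPyramid a v → MeasurableSet (VInf a ⁻¹' {v}) := by
    intro v hv
    have : VInf a ⁻¹' {v} = cylinder v := by
      ext ξ
      exact vInf_eq_iff hr hs hv
    rw [this]
    exact measurableSet_cylinder v
  refine measurable_to_countable' fun v => ?_
  by_cases hv : IsPyramid a v
  · exact hpyr v hv
  -- The fibre of the default value is the complement of the countable union of the pyramidal
  -- fibres.
  by_cases hv1 : v = 1
  · have : VInf (R := R) a ⁻¹' {v} = (⋃ u : {u : TraceMonoid R // IsPyramid a u},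
        VInf a ⁻¹' {u.1})ᶜ := by
      ext ξ
      simp only [Set.mem_preimage, Set.mem_singleton_iff, Set.mem_compl_iff, Set.mem_iUnion,
        Subtype.exists, exists_prop, not_exists, not_and, hv1]
      constructor
      · rintro h u hu hξ
        exact hu.ne_one (hξ.symm.trans h)
      · intro h
        exact (vInf_eq_one_or hr hs a ξ).resolve_right fun h1 => h _ h1 rfl
    rw [this]
    exact (MeasurableSet.iUnion fun u : {u : TraceMonoid R // IsPyramid a u} =>
      hpyr u.1 u.2).compl
  · have : VInf (R := R) a ⁻¹' {v} = ∅ := by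
      ext ξ
      simp only [Set.mem_preimage, Set.mem_singleton_iff, Set.mem_empty_iff_false, iff_false]
      rintro rfl
      exact (vInf_eq_one_or hr hs a ξ).elim hv1 hv
    rw [this]
    exact MeasurableSet.empty

/-! ### Laws of the first pyramid and of the conditioned product -/

section Laws

variable [Fintype α]

theorem IsUniformMeasure.vInf_eq (hr : ∀ a, R a a) (hs : ∀ a b, R a b → R b a) {a : α}
    {m : Measure (Boundary R)} (hm : IsUniformMeasure m) {v : TraceMonoid R} (hv : v ∈ Pyr R a) :
    m {ξ | VInf a ξ = v} = pRoot R Finset.univ ^ len v := by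
  rw [← hm.apply_cylinder]
  congr 1
  ext ξ
  exact vInf_eq_iff hr hs ((mem_pyr_iff hr hs).1 hv)

theorem multMeasure_apply (S : Finset α) (p : ℝ) (A : Set (sub R (S : Set α))) :
    multMeasure R S p A = ∑' x : A,
      ENNReal.ofReal ((mobius R S).eval p * p ^ len ((x : sub R (S : Set α)) : TraceMonoid R)) := by
  have hA : MeasurableSet A := MeasurableSet.of_discrete
  rw [multMeasure, Measure.sum_apply _ hA, tsum_subtype A fun x : sub R (S : Set α) =>
    ENNReal.ofReal ((mobius R S).eval p * p ^ len (x : TraceMonoid R))]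
  refine tsum_congr fun x => ?_
  rw [Measure.smul_apply, Measure.dirac_apply' _ hA, smul_eq_mul]
  by_cases hx : x ∈ A <;> simp [hx]

theorem isProbabilityMeasure_multMeasure (hs : ∀ a b, R a b → R b a) {S : Finset α} {p : ℝ}
    (hp : 0 ≤ p) (h : ENNReal.ofReal p < pRoot R S) :
    IsProbabilityMeasure (multMeasure R S p) := by
  constructor
  have h1 := (summable_iff_lt_pRoot hs hp).2 h
  have h2 := eval_mobius_mul_tsum hs hp h
  have h3 := eval_mobius_pos hs hp h
  rw [multMeasure_apply, tsum_univ (fun x : sub R (S : Set α) =>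
    ENNReal.ofReal ((mobius R S).eval p * p ^ len (x : TraceMonoid R))),
    ← ENNReal.ofReal_tsum_of_nonneg (fun x => by positivity) (h1.mul_left _), tsum_mul_left, h2,
    ENNReal.ofReal_one]

variable [DecidableEq α]

/-- A random trace whose law gives the mass `p_Σ ^ |v|` to every pyramidal trace `v` is almost
surely pyramidal. -/
theorem ae_mem_pyr (hr : ∀ a, R a a) (hs : ∀ a b, R a b → R b a)
    (hirr : (SimpleGraph.fromRel R).Connected) {a : α} {Ω : Type*} [MeasurableSpace Ω]
    {P : Measure Ω} [IsProbabilityMeasure P] {X : Ω → TraceMonoid R} (hX : AEMeasurable X P)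
    (h : ∀ v ∈ Pyr R a, P {ω | X ω = v} = pRoot R Finset.univ ^ len v) :
    ∀ᵐ ω ∂P, X ω ∈ Pyr R a := by
  have : IsProbabilityMeasure (P.map X) := Measure.isProbabilityMeasure_map hX
  -- By `tsum_pyr` the prescribed masses already exhaust the total mass.
  have h1 : P.map X (Pyr R a) = 1 := by
    rw [← Measure.tsum_indicator_apply_singleton _ _ MeasurableSet.of_discrete,
      ← tsum_subtype (Pyr R a) fun v => P.map X {v}, ← tsum_pyr hr hs hirr a]
    refine tsum_congr fun v => ?_
    rw [Measure.map_apply_of_aemeasurable hX (MeasurableSet.singleton _), ← h v v.2]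
    rfl
  exact ae_of_ae_map hX ((prob_compl_eq_zero_iff MeasurableSet.of_discrete).2 h1)

/-- Two random traces whose laws give the mass `p_Σ ^ |v|` to every pyramidal trace `v` have the
same law. -/
theorem identDistrib_of_pyr (hr : ∀ a, R a a) (hs : ∀ a b, R a b → R b a)
    (hirr : (SimpleGraph.fromRel R).Connected) {a : α} {Ω Ω' : Type*} [MeasurableSpace Ω]
    [MeasurableSpace Ω'] {P : Measure Ω} [IsProbabilityMeasure P] {P' : Measure Ω'}
    [IsProbabilityMeasure P'] {X : Ω → TraceMonoid R} {X' : Ω' → TraceMonoid R}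
    (hX : AEMeasurable X P) (hX' : AEMeasurable X' P')
    (h : ∀ v ∈ Pyr R a, P {ω | X ω = v} = pRoot R Finset.univ ^ len v)
    (h' : ∀ v ∈ Pyr R a, P' {ω | X' ω = v} = pRoot R Finset.univ ^ len v) :
    IdentDistrib X X' P P' := by
  refine ⟨hX, hX', Measure.ext_of_singleton fun v => ?_⟩
  rw [Measure.map_apply_of_aemeasurable hX (MeasurableSet.singleton v),
    Measure.map_apply_of_aemeasurable hX' (MeasurableSet.singleton v)]
  change P {ω | X ω = v} = P' {ω | X' ω = v}
  by_cases hv : v ∈ Pyr R a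
  · rw [h v hv, h' v hv]
  · rw [measure_mono_null _ (ae_iff.1 (ae_mem_pyr hr hs hirr hX h)),
      measure_mono_null _ (ae_iff.1 (ae_mem_pyr hr hs hirr hX' h'))]
    · intro ω hω hmem
      exact hv (hω ▸ hmem)
    · intro ω hω hmem
      exact hv (hω ▸ hmem)

/-- The probability of the conditioning event. -/
theorem multMeasure_maxIn (hr : ∀ a, R a a) (hs : ∀ a b, R a b → R b a)
    (hirr : (SimpleGraph.fromRel R).Connected) (a : α) :
    multMeasure R (Finset.univ.erase a) (pRoot R Finset.univ).toReal
      {z | MaxIn (link R a) (z : TraceMonoid R)} =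
    ENNReal.ofReal ((mobius R (Finset.univ.erase a)).eval (pRoot R Finset.univ).toReal /
      (pRoot R Finset.univ).toReal) := by
  have htop : pRoot R Finset.univ < ⊤ := pRoot_lt_top hs ⟨a, Finset.mem_univ a⟩
  have hlt := pRoot_univ_lt hr hs hirr a
  have hpos : 0 < (pRoot R Finset.univ).toReal :=
    ENNReal.toReal_pos (pRoot_pos hs _).ne' htop.ne
  rw [← ENNReal.ofReal_toReal htop.ne] at hlt
  have hμ := eval_mobius_pos hs hpos.le hlt
  have h1 := mul_tsum_basis_pRoot hr hs hirr a
  have h2 := summable_basis hs a hpos.le hlt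
  set p := (pRoot R Finset.univ).toReal
  let e : basis R a ≃ {z : sub R ((Finset.univ.erase a : Finset α) : Set α) |
      MaxIn (link R a) (z : TraceMonoid R)} :=
    { toFun := fun z => ⟨⟨z, basis_subset a z.2⟩, z.2.2⟩
      invFun := fun z => ⟨z.1, mem_sub_erase.1 z.1.2, z.2⟩
      left_inv := fun _ => rfl
      right_inv := fun _ => rfl }
  rw [multMeasure_apply, ← e.tsum_eq]
  change ∑' z : basis R a, ENNReal.ofReal ((mobius R (Finset.univ.erase a)).eval p *
    p ^ len (z : TraceMonoid R)) = _
  rw [← ENNReal.ofReal_tsum_of_nonneg (fun x => by positivity) (h2.mul_left _), tsum_mul_left]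
  congr 1
  rw [eq_div_iff hpos.ne', mul_assoc, mul_comm _ p, h1, mul_one]

/-- The law of `Z * a`, where `Z` is distributed according to the conditioned distribution. -/
theorem cond_multMeasure_eq (hr : ∀ a, R a a) (hs : ∀ a b, R a b → R b a)
    (hirr : (SimpleGraph.fromRel R).Connected) {a : α} {v : TraceMonoid R} (hv : v ∈ Pyr R a) :
    ((multMeasure R (Finset.univ.erase a) (pRoot R Finset.univ).toReal)[|
      {z | MaxIn (link R a) (z : TraceMonoid R)}])
        {z | (z : TraceMonoid R) * letter R a = v} = pRoot R Finset.univ ^ len v := by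
  have htop : pRoot R Finset.univ < ⊤ := pRoot_lt_top hs ⟨a, Finset.mem_univ a⟩
  have hlt := pRoot_univ_lt hr hs hirr a
  have hpos : 0 < (pRoot R Finset.univ).toReal :=
    ENNReal.toReal_pos (pRoot_pos hs _).ne' htop.ne
  rw [← ENNReal.ofReal_toReal htop.ne] at hlt
  have hμ := eval_mobius_pos hs hpos.le hlt
  rw [mem_pyr_iff hr hs] at hv
  obtain ⟨z, rfl⟩ := hv.endsWith
  have hz := (isPyramid_mul_letter hr hs).1 hv
  rw [cond_apply MeasurableSet.of_discrete, multMeasure_maxIn hr hs hirr]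
  -- By right cancellation the event is a single atom.
  have hset : {y : sub R ((Finset.univ.erase a : Finset α) : Set α) |
        MaxIn (link R a) (y : TraceMonoid R)} ∩
      {y | (y : TraceMonoid R) * letter R a = z * letter R a} =
      {(⟨z, mem_sub_erase.2 hz.1⟩ : sub R ((Finset.univ.erase a : Finset α) : Set α))} := by
    ext y
    constructor
    · exact fun h => Subtype.ext (cancel_right hs h.2)
    · rintro rfl
      exact ⟨hz.2, rfl⟩
  rw [hset, multMeasure_apply, tsum_singleton (⟨z, mem_sub_erase.2 hz.1⟩ :
    sub R ((Finset.univ.erase a : Finset α) : Set α)) (fun x =>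
      ENNReal.ofReal ((mobius R (Finset.univ.erase a)).eval (pRoot R Finset.univ).toReal *
        (pRoot R Finset.univ).toReal ^ len (x : TraceMonoid R)))]
  conv_rhs => rw [← ENNReal.ofReal_toReal htop.ne]
  set p := (pRoot R Finset.univ).toReal
  rw [← ENNReal.ofReal_inv_of_pos (by positivity), ← ENNReal.ofReal_mul (by positivity),
    ← ENNReal.ofReal_pow hpos.le, len_mul, len_letter]
  -- What remains is `(μ_{Σ∖a}(p)/p)⁻¹ * μ_{Σ∖a}(p) * p^|z| = p^(|z|+1)`: the normalisation supplies
  -- the factor `p` of the last letter `a`.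
  congr 1
  field_simp
  rw [pow_succ']

end Laws

end TraceMonoid

end

open TraceMonoid in
theorem mainTheorem5 {α : Type*} [Fintype α] [DecidableEq α] (R : α → α → Prop)
    (hrefl : ∀ a, R a a) (hsymm : ∀ a b, R a b → R b a)
    (hirr : (SimpleGraph.fromRel R).Connected) (a₁ : α) :
    -- `0 < p_Σ < p_{Σ∖{a₁}}`
    0 < pRoot R Finset.univ ∧
    pRoot R Finset.univ < pRoot R (Finset.univ.erase a₁) ∧
    -- `B_{Σ∖{a₁}, p_Σ}` is a probability distribution, and the conditioning event is not null
    IsProbabilityMeasure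
      (multMeasure R (Finset.univ.erase a₁) (pRoot R Finset.univ).toReal) ∧
    multMeasure R (Finset.univ.erase a₁) (pRoot R Finset.univ).toReal
      {z | MaxIn (link R a₁) (z : TraceMonoid R)} ≠ 0 ∧
    -- the uniform measure at infinity exists and is unique
    (∃! m : Measure (Boundary R), IsUniformMeasure m) ∧
    ∀ m : Measure (Boundary R), IsUniformMeasure m →
      -- `V_{a₁}` is almost surely defined, with law `p_Σ^|v|` on the pyramidal traces
      (∀ᵐ ξ ∂m, ∃! v, IsVInf a₁ ξ v) ∧
      (∀ v ∈ Pyr R a₁, m {ξ | VInf a₁ ξ = v} = pRoot R Finset.univ ^ len v) ∧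
      -- the output `Z · a₁` of the algorithm, for every output `Z` of `𝒜` with the required law
      ∀ {Ω : Type*} [MeasurableSpace Ω] (P : Measure Ω) [IsProbabilityMeasure P]
        (Z : Ω → sub R ((Finset.univ.erase a₁ : Finset α) : Set α)),
        HasLaw Z
          ((multMeasure R (Finset.univ.erase a₁) (pRoot R Finset.univ).toReal)[|
            {z | MaxIn (link R a₁) (z : TraceMonoid R)}]) P →
        (∀ᵐ ω ∂P, (Z ω : TraceMonoid R) * letter R a₁ ∈ Pyr R a₁) ∧
        (∀ v ∈ Pyr R a₁,
          P {ω | (Z ω : TraceMonoid R) * letter R a₁ = v} = pRoot R Finset.univ ^ len v) ∧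
        IdentDistrib (fun ω => (Z ω : TraceMonoid R) * letter R a₁) (VInf a₁) P m := by
  have htop : pRoot R Finset.univ < ⊤ := pRoot_lt_top hsymm ⟨a₁, Finset.mem_univ a₁⟩
  have hlt := pRoot_univ_lt hrefl hsymm hirr a₁
  have hpos : 0 < (pRoot R Finset.univ).toReal :=
    ENNReal.toReal_pos (pRoot_pos hsymm _).ne' htop.ne
  have hlt' : ENNReal.ofReal (pRoot R Finset.univ).toReal < pRoot R (Finset.univ.erase a₁) := by
    rwa [ENNReal.ofReal_toReal htop.ne]
  refine ⟨pRoot_pos hsymm _, hlt, isProbabilityMeasure_multMeasure hsymm hpos.le hlt', ?_,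
    ⟨prodLaw hrefl hsymm a₁ hirr, isUniformMeasure_prodLaw hrefl hsymm a₁ hirr,
      fun m hm => hm.unique hsymm (isUniformMeasure_prodLaw hrefl hsymm a₁ hirr)⟩,
    fun m hm => ?_⟩
  · rw [multMeasure_maxIn hrefl hsymm hirr]
    exact (ENNReal.ofReal_pos.2 (div_pos (eval_mobius_pos hsymm hpos.le hlt') hpos)).ne'
  · have hprob := hm.prob
    have hV : ∀ v ∈ Pyr R a₁, m {ξ | VInf a₁ ξ = v} = pRoot R Finset.univ ^ len v :=
      fun v hv => hm.vInf_eq hrefl hsymm hv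
    have hVm : AEMeasurable (VInf (R := R) a₁) m := (measurable_vInf hrefl hsymm a₁).aemeasurable
    refine ⟨?_, hV, ?_⟩
    · filter_upwards [ae_mem_pyr hrefl hsymm hirr hVm hV] with ξ hξ
      rw [mem_pyr_iff hrefl hsymm] at hξ
      exact ⟨VInf a₁ ξ, (isVInf_iff hrefl hsymm).2 ⟨hξ, (vInf_eq_iff hrefl hsymm hξ).1 rfl⟩,
        fun v hv => isVInf_unique hrefl hsymm hv
          ((isVInf_iff hrefl hsymm).2 ⟨hξ, (vInf_eq_iff hrefl hsymm hξ).1 rfl⟩)⟩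
    · intro Ω _ P _ Z hZ
      have hZm : AEMeasurable (fun ω => (Z ω : TraceMonoid R) * letter R a₁) P :=
        (Measurable.of_discrete (f := fun z : sub R ((Finset.univ.erase a₁ : Finset α) : Set α) =>
          (z : TraceMonoid R) * letter R a₁)).comp_aemeasurable hZ.aemeasurable
      have hlaw : ∀ v ∈ Pyr R a₁, P {ω | (Z ω : TraceMonoid R) * letter R a₁ = v} =
          pRoot R Finset.univ ^ len v := fun v hv => by
        rw [← cond_multMeasure_eq hrefl hsymm hirr hv]
        exact hZ.measure_eq (p := fun z => (z : TraceMonoid R) * letter R a₁ = v)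
          MeasurableSet.of_discrete
      exact ⟨ae_mem_pyr hrefl hsymm hirr hZm hlaw, hlaw,
        identDistrib_of_pyr hrefl hsymm hirr hZm hVm hlaw hV⟩
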